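/- All graphs are finite and simple. The eigenvalues of a graph are the zeros of the characteristic polynomial of its (0,1) adjacency matrix; a graph is integral if all its eigenvalues are integers; its nullity is the dimension of the kernel of its adjacency matrix (equivalently, the multiplicity of $0$ as an eigenvalue). Theorem. The star $K_{1,4}$ of order $5$ is the only integral tree with nullity $3$. That is, a finite graph $T$ is a tree which is integral and has nullity $3$ if and only if $T$ is isomorphic to the star $K_{1,4}$ with one central vertex and four leaves. -/

import Mathlib

namespace SimpleGraph

/-- A finite graph is integral if all its eigenvalues, that is, all zeros of the characteristic
polynomial of its adjacency matrix, are integers. (The adjacency matrix is real symmetric, so the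
real zeros are all of the zeros.) -/
def IsIntegralGraph {V : Type*} [Fintype V] [DecidableEq V] (G : SimpleGraph V)
    [DecidableRel G.Adj] : Prop :=
  ∀ x : ℝ, (G.adjMatrix ℝ).charpoly.IsRoot x → ∃ k : ℤ, x = (k : ℝ)

/-- The nullity of a finite graph: the dimension of the kernel of its adjacency matrix. -/
noncomputable def nullity {V : Type*} [Fintype V] (G : SimpleGraph V)
    [DecidableRel G.Adj] : ℕ :=
  Module.finrank ℝ (LinearMap.ker (G.adjMatrix ℝ).mulVecLin)

end SimpleGraph

/-! Removing leaves greedily gives a vertex cover `A` of the tree with nullity plus `2 * |A|` at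
most the number of vertices. Along `A` and its complement the adjacency matrix is `K = [[S, B], [Bᵀ,
0]]`. Vectors supported off `A` form an isotropic space, so `K` has at most `|A|` positive and at
most `|A|` negative eigenvalues; the bound on the nullity makes both counts equal to `|A|`.
Integrality pushes the positive eigenvalues up to at least `1`, and the Schur complement of `K - 1`
then shows that `M = S + B Bᵀ - 1` is positive semidefinite.

Since the graph is a tree, `M` has off-diagonal entries 0 or 1. Its diagonal is `k + 1`, where `k +
2` counts the neighbours outside `A`; for nullity three, counting edges gives `∑ k + e(H) = 2`, with
`H` the graph induced on `A`. Semidefiniteness sorts the vertices with `k = 0` into clusters with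
identical rows, and at most two vertices have `k ≠ 0`.

Every configuration except a single cover vertex with four outer neighbours is excluded by a
non-integral eigenvalue `l`. If `H` has no edge, an eigenvalue `y > 0` of `M` yields `l = √(y + 1)`.
In the main cases `M = g gᵀ` with three columns, so `y` may be any nonzero root of an explicit cubic
in the cluster sizes, and some root has `y + 1` strictly between consecutive squares
(`cubicComplete_root`, `cubicPath_root`). The surviving configuration is the star. -/

/-- A positive real `y` such that `y + 1` lies strictly between two consecutive squares. -/
def BetweenSquares (y : ℝ) : Prop :=
  0 < y ∧ ∃ n : ℕ, (n : ℝ) ^ 2 < y + 1 ∧ y + 1 < ((n : ℝ) + 1) ^ 2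

/-! ### Roots of two cubics strictly between shifted squares -/

theorem exists_root_of_neg_pos {F : ℝ → ℝ} (hF : Continuous F) {a b : ℝ} (hab : a ≤ b)
    (ha : F a < 0) (hb : 0 < F b) : ∃ y, a < y ∧ y < b ∧ F y = 0 := by
  obtain ⟨y, hy, h⟩ := intermediate_value_Ioo hab hF.continuousOn ⟨ha, hb⟩
  exact ⟨y, hy.1, hy.2, h⟩

theorem exists_root_of_pos_neg {F : ℝ → ℝ} (hF : Continuous F) {a b : ℝ} (hab : a ≤ b)
    (ha : 0 < F a) (hb : F b < 0) : ∃ y, a < y ∧ y < b ∧ F y = 0 := by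
  obtain ⟨y, hy, h⟩ := intermediate_value_Ioo' hab hF.continuousOn ⟨hb, ha⟩
  exact ⟨y, hy.1, hy.2, h⟩

theorem exists_consecutive_squares (h : ℕ) :
    ∃ n : ℕ, 1 ≤ n ∧ n ^ 2 ≤ h + 1 ∧ h + 1 < (n + 1) ^ 2 :=
  ⟨Nat.sqrt (h + 1), Nat.sqrt_pos.2 (Nat.succ_pos h), Nat.sqrt_le' _, Nat.lt_succ_sqrt' _⟩

theorem betweenSquares_of_lt {n : ℕ} (hn : 1 ≤ n) {y : ℝ} (h1 : (n : ℝ) ^ 2 < y + 1)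
    (h2 : y + 1 < ((n : ℝ) + 1) ^ 2) : BetweenSquares y := by
  refine ⟨?_, n, h1, h2⟩
  have : (1 : ℝ) ≤ n := by exact_mod_cast hn
  nlinarith

/-- The characteristic polynomial of `diag (s₁ - 1, s₂ - 1, s₃ - 1) + J`. -/
def cubicComplete (s₁ s₂ s₃ : ℕ) (y : ℝ) : ℝ :=
  (y - s₁) * (y - s₂) * (y - s₃) - ((y - s₁) + (y - s₂) + (y - s₃)) - 2

/-- The characteristic polynomial of the tridiagonal matrix with diagonal `s₁, s₂, s₃` and ones
next to it. -/
def cubicPath (s₁ s₂ s₃ : ℕ) (y : ℝ) : ℝ :=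
  (y - s₁) * (y - s₂) * (y - s₃) - (y - s₁) - (y - s₃)

theorem continuous_cubicComplete (s₁ s₂ s₃ : ℕ) : Continuous (cubicComplete s₁ s₂ s₃) := by
  unfold cubicComplete; fun_prop

theorem continuous_cubicPath (s₁ s₂ s₃ : ℕ) : Continuous (cubicPath s₁ s₂ s₃) := by
  unfold cubicPath; fun_prop

/-- Take `n` with `n² ≤ s₃ + 1 < (n + 1)²` and put `q = (n + 1)² - 1`. The cubic is negative at
`s₃`; if it is positive at `q`, a root in between works. Otherwise the distances from the `sᵢ` to
`q` are so small that a suitable root can be located directly. -/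
theorem cubicComplete_root_of_sorted {s₁ s₂ s₃ : ℕ} (h₁ : 1 ≤ s₁) (h₁₂ : s₁ ≤ s₂) (h₂₃ : s₂ ≤ s₃)
    (h₃ : s₃ ≠ 1) : ∃ y, BetweenSquares y ∧ cubicComplete s₁ s₂ s₃ y = 0 := by
  obtain ⟨n, hn, hp, hq⟩ := exists_consecutive_squares s₃
  obtain ⟨u₃, hu₃⟩ := Nat.exists_eq_add_of_lt hq
  obtain ⟨v, rfl⟩ := Nat.exists_eq_add_of_le h₂₃
  obtain ⟨w, rfl⟩ := Nat.exists_eq_add_of_le h₁₂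
  -- the gap between the two squares is `2 * n + 1`
  have hgap : s₁ + w + v + 1 + u₃ + 1 = n ^ 2 + (2 * n + 1) := by rw [← hu₃]; ring
  have hu : u₃ ≤ 2 * n := by omega
  have hn' : (1 : ℝ) ≤ n := by exact_mod_cast hn
  have hR : ((s₁ : ℝ) + w + v + 1 + u₃ + 1) = n ^ 2 + (2 * n + 1) := by exact_mod_cast hgap
  have hpR : (n : ℝ) ^ 2 ≤ s₁ + w + v + 1 := by exact_mod_cast hp
  have hneg : cubicComplete s₁ (s₁ + w) (s₁ + w + v) ((s₁ + w + v : ℕ) : ℝ) < 0 := by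
    unfold cubicComplete
    push_cast
    have : (0 : ℝ) ≤ w := by positivity
    have : (0 : ℝ) ≤ v := by positivity
    nlinarith
  have hc := continuous_cubicComplete s₁ (s₁ + w) (s₁ + w + v)
  by_cases hpos : 0 < cubicComplete s₁ (s₁ + w) (s₁ + w + v) ((s₁ + w + v + u₃ + 1 : ℕ) : ℝ)
  · obtain ⟨y, hy1, hy2, hy⟩ := exists_root_of_neg_pos hc (by push_cast; linarith) hneg hpos
    push_cast at hy1 hy2
    exact ⟨y, betweenSquares_of_lt hn (by linarith) (by nlinarith), hy⟩
  -- The three factors are the distances `q - sᵢ`. A nonpositive value at `q` says that their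
  -- product is at most their sum plus 2, which leaves few families.
  have hle : (u₃ + 1 + v + w) * (u₃ + 1 + v) * (u₃ + 1)
      ≤ (u₃ + 1 + v + w) + (u₃ + 1 + v) + (u₃ + 1) + 2 := by
    have : ((u₃ : ℝ) + 1 + v + w) * (u₃ + 1 + v) * (u₃ + 1)
      ≤ (u₃ + 1 + v + w) + (u₃ + 1 + v) + (u₃ + 1) + 2 := by
      have := not_lt.1 hpos
      unfold cubicComplete at this
      push_cast at this
      ring_nf at this ⊢
      linarith
    exact_mod_cast this
  have hcases : (u₃ = 1 ∧ v = 0 ∧ w = 0) ∨ (u₃ = 0 ∧ v = 0) ∨ (u₃ = 0 ∧ v = 1) ∨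
      (u₃ = 0 ∧ v = 2 ∧ w = 0) := by
    have hu1 : u₃ ≤ 1 := by
      by_contra! h
      nlinarith [Nat.zero_le (v * w), Nat.zero_le (v * v), Nat.zero_le (u₃ * v),
        Nat.zero_le (u₃ * w), Nat.zero_le (u₃ * v * w), Nat.zero_le (u₃ * v * v),
        Nat.mul_le_mul h h, Nat.zero_le (u₃ * u₃ * v), Nat.zero_le (u₃ * u₃ * w),
        Nat.mul_le_mul (Nat.mul_le_mul h h) h]
    interval_cases u₃
    · have hv : v ≤ 2 := by
        by_contra! h
        nlinarith [Nat.zero_le (v * w), Nat.mul_le_mul h h]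
      interval_cases v
      · simp
      · simp
      · right; right; right; omega
    · have hv : v = 0 := by
        by_contra! h
        have : 1 ≤ v := Nat.one_le_iff_ne_zero.2 h
        nlinarith [Nat.zero_le (v * w), Nat.mul_le_mul this this]
      subst hv
      left; omega
  rcases hcases with ⟨rfl, rfl, rfl⟩ | ⟨rfl, rfl⟩ | ⟨rfl, rfl⟩ | ⟨rfl, rfl, rfl⟩
  · refine ⟨(s₁ : ℝ) - 1, betweenSquares_of_lt hn ?_ ?_, ?_⟩
    -- For `n = 1` the triple would be `(1, 1, 1)`, which `h₃` excludes.
    · have : 2 ≤ n := by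
        by_contra! h
        obtain rfl : n = 1 := by omega
        omega
      have : (2 : ℝ) ≤ n := by exact_mod_cast this
      push_cast at hR
      linarith
    · push_cast at hR
      nlinarith
    · unfold cubicComplete; push_cast; ring
  · refine ⟨(s₁ : ℝ) + w - 1, betweenSquares_of_lt hn ?_ ?_, ?_⟩
    · push_cast at hR; linarith
    · push_cast at hR; nlinarith
    · unfold cubicComplete; push_cast; ring
  · by_cases h2 : 2 ≤ n
    · have : (2 : ℝ) ≤ n := by exact_mod_cast h2
      push_cast at hR
      by_cases hw : w = 0
      · subst hw
        refine ⟨(s₁ : ℝ) - 1, betweenSquares_of_lt hn ?_ ?_, ?_⟩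
        · push_cast at hR; linarith
        · push_cast at hR; nlinarith
        · unfold cubicComplete; push_cast; ring
      · have hw : (1 : ℝ) ≤ w := by exact_mod_cast Nat.one_le_iff_ne_zero.2 hw
        obtain ⟨y, hy1, hy2, hy⟩ := exists_root_of_pos_neg hc (a := s₁ + w - 1) (b := s₁ + w)
          (by linarith) (by unfold cubicComplete; push_cast; ring_nf; linarith)
          (by unfold cubicComplete; push_cast; ring_nf; linarith)
        exact ⟨y, betweenSquares_of_lt hn (by linarith) (by nlinarith), hy⟩
    · obtain rfl : n = 1 := by omega
      obtain ⟨rfl, rfl⟩ : s₁ = 1 ∧ w = 0 := by omega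
      -- For the triple `(1, 1, 2)` the roots are `0` and `2 ± √2`; the one wanted is `2 - √2`.
      obtain ⟨y, hy1, hy2, hy⟩ := exists_root_of_pos_neg hc (a := 1 / 2) (b := 1)
          (by norm_num) (by unfold cubicComplete; norm_num) (by unfold cubicComplete; norm_num)
      exact ⟨y, betweenSquares_of_lt le_rfl (by norm_num; linarith) (by norm_num; linarith), hy⟩
  · refine ⟨(s₁ : ℝ), betweenSquares_of_lt hn ?_ ?_, ?_⟩
    · have : 2 ≤ n := by
        by_contra! h
        obtain rfl : n = 1 := by omega
        omega
      have : (2 : ℝ) ≤ n := by exact_mod_cast this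
      push_cast at hR
      linarith
    · push_cast at hR; nlinarith
    · unfold cubicComplete; push_cast; ring

theorem cubicComplete_root {s₁ s₂ s₃ : ℕ} (h₁ : 1 ≤ s₁) (h₂ : 1 ≤ s₂) (h₃ : 1 ≤ s₃)
    (h : ¬ (s₁ = 1 ∧ s₂ = 1 ∧ s₃ = 1)) :
    ∃ y, BetweenSquares y ∧ cubicComplete s₁ s₂ s₃ y = 0 := by
  have swap₁ : ∀ a b c : ℕ, cubicComplete a b c = cubicComplete b a c := by
    intro a b c; funext y; unfold cubicComplete; ring
  have swap₂ : ∀ a b c : ℕ, cubicComplete a b c = cubicComplete a c b := by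
    intro a b c; funext y; unfold cubicComplete; ring
  rcases le_total s₁ s₂ with h12 | h12 <;> rcases le_total s₂ s₃ with h23 | h23 <;>
    rcases le_total s₁ s₃ with h13 | h13
  · exact cubicComplete_root_of_sorted h₁ h12 h23 (by omega)
  · exact cubicComplete_root_of_sorted h₁ h12 h23 (by omega)
  · rw [swap₂]; exact cubicComplete_root_of_sorted h₁ h13 h23 (by omega)
  · rw [swap₂, swap₁]; exact cubicComplete_root_of_sorted h₃ h13 h12 (by omega)
  · rw [swap₁]; exact cubicComplete_root_of_sorted h₂ h12 h13 (by omega)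
  · rw [swap₁, swap₂]; exact cubicComplete_root_of_sorted h₂ h23 h13 (by omega)
  · rw [swap₁, swap₂, swap₁]; exact cubicComplete_root_of_sorted h₃ h23 h12 (by omega)
  · rw [swap₁, swap₂, swap₁]; exact cubicComplete_root_of_sorted h₃ h23 h12 (by omega)

set_option maxHeartbeats 800000 in
-- Same strategy as for `cubicComplete`, starting from `h = max s₂ s₃`. The value at `h` may now
-- vanish, and a nonpositive value at `q` bounds the product of the distances by the sum of the two
-- outer ones.
theorem cubicPath_root_of_le {s₁ s₂ s₃ : ℕ} (h₁ : 1 ≤ s₁) (h₁₃ : s₁ ≤ s₃) :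
    ∃ y, BetweenSquares y ∧ cubicPath s₁ s₂ s₃ y = 0 := by
  obtain ⟨n, hn, hp, hq⟩ := exists_consecutive_squares (max s₂ s₃)
  obtain ⟨h, hh⟩ : ∃ h, h = max s₂ s₃ := ⟨_, rfl⟩
  rw [← hh] at hp hq
  obtain ⟨q, hqd⟩ : ∃ q, q + 1 = (n + 1) ^ 2 := ⟨(n + 1) ^ 2 - 1, by
    have : 0 < (n + 1) ^ 2 := by positivity
    omega⟩
  have hgap : q + 1 = n ^ 2 + (2 * n + 1) := by rw [hqd]; ring
  have hn' : (1 : ℝ) ≤ n := by exact_mod_cast hn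
  have hR : (q : ℝ) + 1 = n ^ 2 + (2 * n + 1) := by exact_mod_cast hgap
  have hpR : (n : ℝ) ^ 2 ≤ h + 1 := by exact_mod_cast hp
  have h2h : s₂ ≤ h := by omega
  have h3h : s₃ ≤ h := by omega
  have hhq : h < q := by omega
  have hc := continuous_cubicPath s₁ s₂ s₃
  have h1R : (s₁ : ℝ) ≤ h := by exact_mod_cast h₁₃.trans h3h
  have h2R : (s₂ : ℝ) ≤ h := by exact_mod_cast h2h
  have h3R : (s₃ : ℝ) ≤ h := by exact_mod_cast h3h
  have hhqR : (h : ℝ) < q := by exact_mod_cast hhq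
  have good : ∀ y : ℝ, h < y → y < q → BetweenSquares y := fun y hy1 hy2 ↦
    betweenSquares_of_lt hn (by linarith) (by nlinarith)
  have hh' : h = s₂ ∨ h = s₃ := by omega
  have hle : cubicPath s₁ s₂ s₃ h ≤ 0 := by
    unfold cubicPath
    rcases hh' with h' | h' <;> rw [h'] at h1R h2R h3R ⊢ <;> simp <;> linarith
  by_cases hpos : 0 < cubicPath s₁ s₂ s₃ q
  · rcases hle.lt_or_eq with hlt | heq
    · obtain ⟨y, hy1, hy2, hy⟩ := exists_root_of_neg_pos hc hhqR.le hlt hpos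
      exact ⟨y, good y hy1 hy2, hy⟩
    -- A zero at `h` forces `s₁ = s₃ = h`. Then `y - s₃` splits off and the remaining quadratic has
    -- a root strictly beyond `h`.
    · have h13 : s₁ = h ∧ s₃ = h := by
        have : (h : ℝ) = s₁ ∧ (h : ℝ) = s₃ := by
          unfold cubicPath at heq
          rcases hh' with h' | h' <;> rw [h'] at h1R h2R h3R heq ⊢ <;> simp at heq <;>
            constructor <;> linarith
        exact ⟨by exact_mod_cast this.1.symm, by exact_mod_cast this.2.symm⟩
      obtain ⟨rfl, h3⟩ := h13
      subst h3
      unfold cubicPath at hpos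
      have hpos' : 0 < ((q : ℝ) - s₃) * (((q : ℝ) - s₂) * (q - s₃) - 2) := by
        ring_nf at hpos ⊢; linarith
      have hpos'' := (mul_pos_iff_of_pos_left (by linarith)).1 hpos'
      obtain ⟨y, hy1, hy2, hy⟩ := exists_root_of_neg_pos
        (F := fun y ↦ (y - (s₂ : ℝ)) * (y - s₃) - 2) (by fun_prop) hhqR.le (by simp) hpos''
      refine ⟨y, good y hy1 hy2, ?_⟩
      unfold cubicPath
      linear_combination (y - (s₃ : ℝ)) * hy
  obtain ⟨u₁, hu₁⟩ := Nat.exists_eq_add_of_lt (lt_of_le_of_lt (h₁₃.trans h3h) hhq)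
  obtain ⟨u₂, hu₂⟩ := Nat.exists_eq_add_of_lt (lt_of_le_of_lt h2h hhq)
  obtain ⟨u₃, hu₃⟩ := Nat.exists_eq_add_of_lt (lt_of_le_of_lt h3h hhq)
  have e1 : (s₁ : ℝ) = q - u₁ - 1 := by rw [hu₁]; push_cast; ring
  have e2 : (s₂ : ℝ) = q - u₂ - 1 := by rw [hu₂]; push_cast; ring
  have e3 : (s₃ : ℝ) = q - u₃ - 1 := by rw [hu₃]; push_cast; ring
  have hprod : (u₁ + 1) * (u₂ + 1) * (u₃ + 1) ≤ (u₁ + 1) + (u₃ + 1) := by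
    have : ((u₁ : ℝ) + 1) * (u₂ + 1) * (u₃ + 1) ≤ (u₁ + 1) + (u₃ + 1) := by
      have := not_lt.1 hpos
      unfold cubicPath at this
      rw [e1, e2, e3] at this
      ring_nf at this ⊢
      linarith
    exact_mod_cast this
  have hu31 : u₃ ≤ u₁ := by omega
  have root : ∀ k : ℝ, 1 ≤ k → k ≤ 2 → cubicPath s₁ s₂ s₃ (q - k) = 0 →
      ∃ y, BetweenSquares y ∧ cubicPath s₁ s₂ s₃ y = 0 := fun k hk1 hk2 hk ↦
    ⟨q - k, betweenSquares_of_lt hn (by linarith) (by nlinarith), hk⟩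
  have hcases : (u₃ = 0 ∧ u₂ = 0) ∨ (u₁ = 0 ∧ u₂ = 1 ∧ u₃ = 0) ∨ (u₁ = 1 ∧ u₂ = 0 ∧ u₃ = 1) := by
    have hu3 : u₃ ≤ 1 := by
      by_contra! h
      nlinarith [Nat.zero_le (u₁ * u₂ * u₃), Nat.zero_le (u₂ * u₃), Nat.zero_le (u₁ * u₂),
        Nat.mul_le_mul_left u₁ h]
    interval_cases u₃
    · have hu2 : u₂ ≤ 1 := by
        by_contra! h
        nlinarith [Nat.mul_le_mul_left u₁ h]
      interval_cases u₂
      · simp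
      · omega
    · have hu2 : u₂ = 0 := by
        by_contra! h
        have h : 1 ≤ u₂ := Nat.one_le_iff_ne_zero.2 h
        nlinarith [Nat.mul_le_mul_left u₁ h]
      subst hu2
      omega
  rcases hcases with ⟨rfl, rfl⟩ | ⟨rfl, rfl, rfl⟩ | ⟨rfl, rfl, rfl⟩
  · by_cases hu : u₁ = 0
    · subst hu
      exact root 1 le_rfl (by norm_num) (by unfold cubicPath; rw [e1, e2, e3]; push_cast; ring)
    · have hu : (1 : ℝ) ≤ u₁ := by exact_mod_cast Nat.one_le_iff_ne_zero.2 hu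
      obtain ⟨y, hy1, hy2, hy⟩ := exists_root_of_pos_neg hc (a := q - 2) (b := q - 1)
          (by linarith) (by unfold cubicPath; rw [e1, e2, e3]; push_cast; ring_nf; linarith)
          (by unfold cubicPath; rw [e1, e2, e3]; push_cast; ring_nf; linarith)
      exact ⟨y, betweenSquares_of_lt hn (by linarith) (by nlinarith), hy⟩
  · exact root 1 le_rfl (by norm_num) (by unfold cubicPath; rw [e1, e2, e3]; push_cast; ring)
  · exact root 2 (by norm_num) le_rfl (by unfold cubicPath; rw [e1, e2, e3]; push_cast; ring)

theorem cubicPath_root {s₁ s₂ s₃ : ℕ} (h₁ : 1 ≤ s₁) (h₃ : 1 ≤ s₃) :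
    ∃ y, BetweenSquares y ∧ cubicPath s₁ s₂ s₃ y = 0 := by
  rcases le_total s₁ s₃ with h | h
  · exact cubicPath_root_of_le (s₂ := s₂) h₁ h
  · obtain ⟨y, hy, h0⟩ := cubicPath_root_of_le (s₂ := s₂) h₃ h
    refine ⟨y, hy, ?_⟩
    rw [← h0]; unfold cubicPath; ring

/-! ### Eigenvectors from Gram matrices -/

open Matrix

/-- A nonzero eigenvalue of `∑ₐ gₐ gₐᵀ` is an eigenvalue of the Gram matrix of the `gₐ`. -/
theorem exists_eigenvector_gram {α ι : Type*} [Fintype α] [Fintype ι] [DecidableEq ι]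
    (g : Matrix α ι ℝ) {y : ℝ} (hy : y ≠ 0)
    (hdet : (scalar ι y - gᵀ * g).det = 0) :
    ∃ x : α → ℝ, x ≠ 0 ∧ (g * gᵀ) *ᵥ x = y • x := by
  obtain ⟨v, hv, hv0⟩ := Matrix.exists_mulVec_eq_zero_iff.2 hdet
  have hv' : (gᵀ * g) *ᵥ v = y • v := by
    rw [sub_mulVec, sub_eq_zero] at hv0
    rw [← hv0]
    ext i; simp [Matrix.scalar_apply, mulVec_diagonal]
  refine ⟨g *ᵥ v, fun h ↦ hv ?_, ?_⟩
  · rw [← mulVec_mulVec, h, mulVec_zero] at hv'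
    exact (smul_eq_zero.1 hv'.symm).resolve_left hy
  · rw [← mulVec_mulVec, mulVec_mulVec v, hv', mulVec_smul]

theorem exists_eigenvector_of_cubicComplete {α : Type*} [Fintype α] {g : Matrix α (Fin 3) ℝ}
    {t₁ t₂ t₃ : ℕ} {y : ℝ} (hg : gᵀ * g = !![(t₁ : ℝ) + 1, 1, 1; 1, t₂ + 1, 1; 1, 1, t₃ + 1])
    (hy : y ≠ 0) (h0 : cubicComplete (t₁ + 1) (t₂ + 1) (t₃ + 1) y = 0) :
    ∃ x : α → ℝ, x ≠ 0 ∧ (g * gᵀ) *ᵥ x = y • x := by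
  refine exists_eigenvector_gram g hy ?_
  rw [hg, det_fin_three]
  refine Eq.trans ?_ h0
  simp [cubicComplete, Matrix.scalar_apply]
  ring

theorem exists_eigenvector_of_cubicPath {α : Type*} [Fintype α] {g : Matrix α (Fin 3) ℝ}
    {t₁ t₂ t₃ : ℕ} {y : ℝ} (hg : gᵀ * g = !![(t₁ : ℝ) + 1, 1, 0; 1, t₂ + 2, 1; 0, 1, t₃ + 1])
    (hy : y ≠ 0) (h0 : cubicPath (t₁ + 1) (t₂ + 2) (t₃ + 1) y = 0) :
    ∃ x : α → ℝ, x ≠ 0 ∧ (g * gᵀ) *ᵥ x = y • x := by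
  refine exists_eigenvector_gram g hy ?_
  rw [hg, det_fin_three]
  refine Eq.trans ?_ h0
  simp [cubicPath, Matrix.scalar_apply]

/-! ### Classification of integral covers -/

/-- The data attached to a minimum vertex cover of an integral tree of nullity three: `M` is the
matrix `S + B Bᵀ - 1`, where `S` is the adjacency matrix of the graph `H` induced on the cover and
`B` is the incidence matrix between the cover and its complement. -/
structure IntegralCover {α : Type*} [Fintype α] [DecidableEq α] (M : Matrix α α ℝ)
    (H : SimpleGraph α) [DecidableRel H.Adj] (k : α → ℕ) : Prop where
  psd : M.PosSemidef
  diag : ∀ a, M a a = k a + 1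
  offdiag : ∀ a b, a ≠ b → M a b = 0 ∨ M a b = 1
  conn : ∀ P : α → Prop, (∃ a, P a) → (∀ a b, P a → M a b ≠ 0 → P b) → ∀ b, P b
  no_cycle : ∀ a b c, H.Adj a b → c ≠ a → c ≠ b → M a c = 1 → M b c ≠ 1
  count : ∑ a, k a + H.edgeFinset.card = 2
  eig : ∀ l : ℝ, 0 < l → ∀ x : α → ℝ, x ≠ 0 →
    M *ᵥ x = (l ^ 2 - 1) • x - (l - 1) • (H.adjMatrix ℝ *ᵥ x) → ∃ n : ℤ, l = n

theorem mulVec_sum_single {α : Type*} [Fintype α] [DecidableEq α] (M : Matrix α α ℝ) {n : ℕ}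
    (v : Fin n → α) (w : Fin n → ℝ) (d : α) :
    (M *ᵥ ∑ i, Pi.single (v i) (w i)) d = ∑ i, M d (v i) * w i := by
  rw [mulVec_sum, Finset.sum_apply]
  simp

theorem dotProduct_mulVec_sum_single {α : Type*} [Fintype α] [DecidableEq α] (M : Matrix α α ℝ)
    {n : ℕ} (v : Fin n → α) (w : Fin n → ℝ) :
    (∑ i, Pi.single (v i) (w i)) ⬝ᵥ (M *ᵥ ∑ i, Pi.single (v i) (w i)) =
      ∑ i, ∑ j, w i * M (v i) (v j) * w j := by
  rw [sum_dotProduct]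
  simp [mulVec_sum_single, Finset.mul_sum, mul_assoc]

/-- Pigeonhole: the hypothesis `h` says that the equivalence relation has at most `m` classes on
`p`, so the classes can be labelled by `Fin m`. -/
theorem exists_fin_map_of_relation {α : Type*} [Finite α] {p : α → Prop} {r : α → α → Prop} {m : ℕ}
    (hm : 0 < m) (refl : ∀ a, p a → r a a) (symm : ∀ a b, r a b → r b a)
    (trans : ∀ a b c, p a → p b → p c → r a b → r b c → r a c)
    (h : ∀ v : Fin (m + 1) → α, (∀ i, p (v i)) → ∃ i j, i ≠ j ∧ r (v i) (v j)) :
    ∃ f : α → Fin m, ∀ a b, p a → p b → (r a b ↔ f a = f b) := by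
  classical
  let s : Setoid {a // p a} :=
    ⟨fun a b ↦ r a b, fun a ↦ refl a a.2, fun {a b} ↦ symm a b,
      fun {a b c} ↦ trans a b c a.2 b.2 c.2⟩
  have := Fintype.ofFinite (Quotient s)
  have hcard : Fintype.card (Quotient s) ≤ Fintype.card (Fin m) := by
    by_contra! hlt
    obtain ⟨e⟩ : Nonempty (Fin (m + 1) ↪ Quotient s) :=
      Function.Embedding.nonempty_of_card_le (by simpa [Nat.succ_le_iff] using hlt)
    obtain ⟨i, j, hij, hr⟩ := h (fun i ↦ (e i).out) (fun i ↦ (e i).out.2)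
    apply hij
    apply e.injective
    rw [← Quotient.out_eq (e i), ← Quotient.out_eq (e j)]
    exact Quotient.sound hr
  obtain ⟨e⟩ := Function.Embedding.nonempty_of_card_le hcard
  refine ⟨fun a ↦ if ha : p a then e ⟦⟨a, ha⟩⟧ else ⟨0, hm⟩, fun a b ha hb ↦ ?_⟩
  simp only [ha, hb, dif_pos, EmbeddingLike.apply_eq_iff_eq]
  exact (Quotient.eq (r := s) (x := ⟨a, ha⟩) (y := ⟨b, hb⟩)).symm

theorem BetweenSquares.sqrt_ne_intCast {y : ℝ} (hy : BetweenSquares y) (m : ℤ) :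
    √(y + 1) ≠ m := by
  obtain ⟨hy0, n, h1, h2⟩ := hy
  intro h
  have h1' : (n : ℝ) < m := h ▸ Real.lt_sqrt_of_sq_lt h1
  have h2' : (m : ℝ) < n + 1 := by
    rw [← h, Real.sqrt_lt' (by positivity)]
    exact h2
  have h1'' : (n : ℤ) < m := by exact_mod_cast h1'
  have h2'' : m < n + 1 := by exact_mod_cast h2'
  omega

namespace IntegralCover

variable {α : Type*} [Fintype α] [DecidableEq α] {M : Matrix α α ℝ}
    {H : SimpleGraph α} [DecidableRel H.Adj] {k : α → ℕ}

theorem symm (h : IntegralCover M H k) (a b : α) : M a b = M b a := by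
  simpa using h.psd.1.apply b a

theorem form_nonneg (h : IntegralCover M H k) {n : ℕ} (v : Fin n → α) (w : Fin n → ℝ) :
    0 ≤ ∑ i, ∑ j, w i * M (v i) (v j) * w j := by
  rw [← dotProduct_mulVec_sum_single]
  simpa using h.psd.dotProduct_mulVec_nonneg (∑ i, Pi.single (v i) (w i))

theorem null_of_form_eq_zero (h : IntegralCover M H k) {n : ℕ} (v : Fin n → α) (w : Fin n → ℝ)
    (h0 : ∑ i, ∑ j, w i * M (v i) (v j) * w j = 0) (d : α) : ∑ i, M d (v i) * w i = 0 := by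
  rw [← dotProduct_mulVec_sum_single] at h0
  have := (h.psd.dotProduct_mulVec_zero_iff (∑ i, Pi.single (v i) (w i))).1 (by simpa using h0)
  rw [← mulVec_sum_single, this, Pi.zero_apply]

/-- The vector `e_a - e_b` is isotropic for the semidefinite form, hence in the kernel of `M`. This
is what creates the clusters. -/
theorem row_eq (h : IntegralCover M H k) {a b : α} (ha : k a = 0) (hb : k b = 0)
    (hab : M a b = 1) (d : α) : M d a = M d b := by
  have := h.null_of_form_eq_zero ![a, b] ![1, -1]
    (by simp [Fin.sum_univ_succ, h.diag, ha, hb, hab, h.symm b a]) d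
  simp [Fin.sum_univ_succ] at this
  linarith

theorem entry_eq_one (h : IntegralCover M H k) {a b : α} (hab : a ≠ b) (h0 : M a b ≠ 0) :
    M a b = 1 := (h.offdiag a b hab).resolve_left h0

theorem not_betweenSquares (h : IntegralCover M H k) (hH : H.edgeFinset.card = 0) {y : ℝ}
    {x : α → ℝ} (hx : x ≠ 0) (hMx : M *ᵥ x = y • x) : ¬ BetweenSquares y := by
  intro hy
  have hH' : ∀ a b, ¬ H.Adj a b := by
    intro a b hab
    rw [Finset.card_eq_zero] at hH
    have := (SimpleGraph.mem_edgeFinset (G := H) (e := s(a, b))).2 hab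
    simp [hH] at this
  have hsq : √(y + 1) ^ 2 = y + 1 := Real.sq_sqrt (by linarith [hy.1])
  obtain ⟨n, hn⟩ := h.eig √(y + 1) (Real.sqrt_pos.2 (by linarith [hy.1])) x hx (by
    have : H.adjMatrix ℝ *ᵥ x = 0 := by
      ext a
      rw [SimpleGraph.adjMatrix_mulVec_apply, Pi.zero_apply]
      exact Finset.sum_eq_zero fun b hb ↦ absurd ((H.mem_neighborFinset a b).1 hb) (hH' a b)
    rw [this, hMx, hsq]
    simp)
  exact hy.sqrt_ne_intCast n hn

/-- Otherwise connectedness makes `M` the all-ones matrix while `H` has two edges; an edge and any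
third vertex then contradict `no_cycle`. -/
theorem exists_special (h : IntegralCover M H k) : ∃ a, k a ≠ 0 := by
  by_contra! hk
  have hall : ∀ a b, M a b = 1 := by
    intro a
    refine h.conn _ ⟨a, by simp [h.diag, hk]⟩ fun b c hb hbc ↦ ?_
    have h1 : M b c = 1 := by
      by_cases hbc' : b = c
      · simp [hbc', h.diag, hk]
      · exact h.entry_eq_one hbc' hbc
    rw [h.symm, h.row_eq (hk a) (hk b) hb, h.symm, h1]
  have hcard : H.edgeFinset.card = 2 := by simpa [hk] using h.count
  obtain ⟨e, he⟩ : H.edgeFinset.Nonempty := Finset.card_pos.1 (by omega)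
  induction e with | _ a b
  have hab : H.Adj a b := by simpa using he
  have hα : 2 < Fintype.card α := by
    by_contra! hle
    have := (H.card_edgeFinset_le_card_choose_two).trans (Nat.choose_le_choose 2 hle)
    rw [hcard] at this
    simp at this
  obtain ⟨c, -, hc⟩ : ∃ c ∈ (Finset.univ : Finset α), c ∉ ({a, b} : Finset α) :=
    Finset.exists_mem_notMem_of_card_lt_card (lt_of_le_of_lt Finset.card_le_two (by simpa using hα))
  simp only [Finset.mem_insert, Finset.mem_singleton, not_or] at hc
  exact h.no_cycle a b c hab hc.1 hc.2 (hall a c) (hall b c)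

/-- Ordinary neighbours have equal rows, so adjacency to `a₀` propagates along every chain. -/
theorem adj_special (h : IntegralCover M H k) {a₀ : α} (hk : ∀ a, a ≠ a₀ → k a = 0) :
    ∀ c, c ≠ a₀ → M a₀ c = 1 := by
  suffices ∀ c, c = a₀ ∨ M a₀ c = 1 from fun c hc ↦ (this c).resolve_left hc
  refine h.conn _ ⟨a₀, .inl rfl⟩ fun a b ha hab ↦ ?_
  by_cases hb : b = a₀
  · exact .inl hb
  refine .inr ?_
  by_cases ha0 : a = a₀
  · subst ha0
    exact h.entry_eq_one (Ne.symm hb) hab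
  have h1 := ha.resolve_left ha0
  by_cases hab' : a = b
  · rwa [← hab']
  rw [← h.row_eq (hk a ha0) (hk b hb) (h.entry_eq_one hab' hab), h1]

/-- Here `H` has exactly one edge, which `no_cycle` forces to be `a₀b` with `b` separated in `M`
from all remaining vertices; these form a single cluster of size `t`. The eigenvalue equation
reduces to three unknowns and has a solution with `1 < l < 2`. -/
theorem special_ne_one_of_unique (h : IntegralCover M H k) {a₀ : α}
    (hk : ∀ a, a ≠ a₀ → k a = 0) : k a₀ ≠ 1 := by
  intro hk0
  have hsum : ∑ a, k a = 1 := by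
    rw [Fintype.sum_eq_single a₀ hk, hk0]
  have hcard : H.edgeFinset.card = 1 := by have := h.count; omega
  have hadj := h.adj_special hk
  obtain ⟨e, he⟩ := Finset.card_eq_one.1 hcard
  have hHe : ∀ x y, H.Adj x y ↔ s(x, y) = e := by
    intro x y
    rw [← SimpleGraph.mem_edgeSet, ← SimpleGraph.mem_edgeFinset, he, Finset.mem_singleton]
  obtain ⟨b, hb⟩ : ∃ b, e = s(a₀, b) := by
    induction e with | _ x y
    by_cases hx : x = a₀
    · exact ⟨y, by rw [hx]⟩
    by_cases hy : y = a₀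
    · exact ⟨x, by rw [hy, Sym2.eq_swap]⟩
    have hxy : H.Adj x y := (hHe x y).2 rfl
    exact absurd (by rw [h.symm, hadj y hy])
      (h.no_cycle x y a₀ hxy (Ne.symm hx) (Ne.symm hy) (by rw [h.symm, hadj x hx]))
  subst hb
  have hab : H.Adj a₀ b := (hHe _ _).2 rfl
  have hb0 : b ≠ a₀ := hab.ne'
  have hbc : ∀ c, c ≠ a₀ → c ≠ b → M b c = 0 := fun c hc0 hcb ↦
    (h.offdiag b c hcb.symm).resolve_right
      (h.no_cycle a₀ b c hab hc0 hcb (hadj c hc0))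
  have hcc : ∀ c d, c ≠ a₀ → c ≠ b → d ≠ a₀ → d ≠ b → M c d = 1 := by
    intro c d hc0 hcb hd0 hdb
    by_cases hcd : c = d
    · simp [hcd, h.diag, hk d hd0]
    refine h.entry_eq_one hcd fun h0 ↦ ?_
    -- If `M c d = 0`, the form takes the value `5 - 6 = -1` on this vector.
    have := h.form_nonneg ![a₀, b, c, d] ![1, -1, -1, -1]
    simp [Fin.sum_univ_succ, h.diag, hk0, hk b hb0, hk c hc0, hk d hd0, h.symm b a₀, h.symm c a₀,
      h.symm d a₀, hadj b hb0, hadj c hc0, hadj d hd0, h.symm c b, h.symm d b, hbc c hc0 hcb,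
      hbc d hd0 hdb, h.symm d c, h0] at this
    norm_num at this
  set t : ℕ := (Finset.univ.filter fun c ↦ c ≠ a₀ ∧ c ≠ b).card with ht
  -- With `z = l²`, the equation at `b` allows the values `z - 2` at `a₀` and `l` at `b`. The other
  -- two equations then give `z - 4` on the cluster and this quadratic for `z`, whose values are `1
  -- + 3t` at 1 and `-2` at 4.
  obtain ⟨z, hz1, hz4, hz⟩ := exists_root_of_pos_neg
    (F := fun z : ℝ ↦ z ^ 2 - (6 + t) * z + 6 + 4 * t) (by fun_prop) (a := 1) (b := 4)
    (by norm_num) (by ring_nf; positivity) (by ring_nf; norm_num)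
  set l := √z with hl
  have hlz : l ^ 2 = z := Real.sq_sqrt (by linarith)
  have hl1 : 1 < l := Real.lt_sqrt_of_sq_lt (by simpa using hz1)
  have hl2 : l < 2 := (Real.sqrt_lt' (by norm_num)).2 (by norm_num; exact hz4)
  let x : α → ℝ := fun c ↦ if c = a₀ then z - 2 else if c = b then l else z - 4
  have xa : x a₀ = z - 2 := if_pos rfl
  have xb : x b = l := by simp [x, hb0]
  have xc : ∀ c, c ≠ a₀ → c ≠ b → x c = z - 4 := fun c h1 h2 ↦ by simp [x, h1, h2]
  have hsumx : ∀ u : α → ℝ, ∑ c, u c = u a₀ + u b + ∑ c with c ≠ a₀ ∧ c ≠ b, u c := by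
    intro u
    rw [← Finset.sum_filter_add_sum_filter_not Finset.univ (fun c ↦ c ≠ a₀ ∧ c ≠ b), add_comm]
    congr 1
    rw [← Finset.sum_pair hb0.symm]
    refine Finset.sum_congr ?_ fun _ _ ↦ rfl
    ext c; simp; tauto
  have hrest : ∀ u : α → ℝ, ∀ r : ℝ, (∀ c, c ≠ a₀ → c ≠ b → u c = r) →
      ∑ c with c ≠ a₀ ∧ c ≠ b, u c = t * r := by
    intro u r hu
    rw [Finset.sum_congr rfl fun c hc ↦ hu c (Finset.mem_filter.1 hc).2.1
      (Finset.mem_filter.1 hc).2.2]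
    simp [ht]
  obtain ⟨n, hn⟩ := h.eig l (by linarith) x (fun h0 ↦ by
    rw [h0] at xb; simp at xb; linarith) (by
    ext c
    have hS : (H.adjMatrix ℝ *ᵥ x) c = ∑ d, (if H.Adj c d then x d else 0) := by
      simp [mulVec, dotProduct, SimpleGraph.adjMatrix_apply]
    simp only [Pi.sub_apply, Pi.smul_apply, smul_eq_mul, hS]
    simp only [mulVec, dotProduct]
    rw [hsumx, hsumx]
    by_cases hc0 : c = a₀
    · subst hc0
      rw [hrest _ (z - 4) fun d h1 h2 ↦ by rw [hadj d h1, xc d h1 h2, one_mul],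
        hrest _ 0 fun d h1 h2 ↦ if_neg (by rw [hHe]; simp [h2, h1])]
      simp only [h.diag, hk0, hadj b hb0, xa, xb, hHe, hlz]
      simp [hb0.symm]
      linear_combination hlz - hz
    by_cases hcb : c = b
    · subst hcb
      rw [hrest _ 0 fun d h1 h2 ↦ by rw [hbc d h1 h2, zero_mul],
        hrest _ 0 fun d h1 h2 ↦ if_neg (by rw [hHe]; simp [h2, h1])]
      simp only [h.diag, hk c hb0, h.symm c a₀, hadj c hb0, xa, xb, hHe, hlz]
      simp [hb0]
      ring
    · rw [hrest _ (z - 4) fun d h1 h2 ↦ by rw [hcc c d hc0 hcb h1 h2, xc d h1 h2, one_mul],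
        hrest _ 0 fun d h1 h2 ↦ if_neg (by rw [hHe]; simp [hc0, hcb])]
      simp only [h.symm c a₀, hadj c hc0, h.symm c b, hbc c hc0 hcb, xa, xb, xc c hc0 hcb, hHe, hlz]
      simp [hc0, hcb]
      linear_combination -hz)
  rw [hn] at hl1 hl2
  have h1 : (1 : ℤ) < n := by exact_mod_cast hl1
  have h2 : n < (2 : ℤ) := by exact_mod_cast hl2
  omega

/-- The ordinary vertices form at most three clusters, all joined to `a₀`. With rows `(1, 1, 1)` for
`a₀` and unit vectors for the clusters, `M = g gᵀ`, and the Gram matrix is `diag t + J`. A nonempty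
cluster makes `cubicComplete_root` applicable. -/
theorem eq_special_of_unique (h : IntegralCover M H k) {a₀ : α}
    (hk0 : k a₀ = 2) (hk : ∀ a, a ≠ a₀ → k a = 0) : ∀ a, a = a₀ := by
  have hsum : ∑ a, k a = 2 := by rw [Fintype.sum_eq_single a₀ hk, hk0]
  have hcard : H.edgeFinset.card = 0 := by have := h.count; omega
  have hadj := h.adj_special hk
  have hone : ∀ a, a ≠ a₀ → M a a = 1 := fun a ha ↦ by simp [h.diag, hk a ha]
  obtain ⟨f, hf⟩ := exists_fin_map_of_relation (p := fun a ↦ a ≠ a₀) (r := fun a b ↦ M a b = 1)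
    (m := 3) (by norm_num) hone (fun a b hab ↦ by rw [h.symm, hab])
    (fun a b c ha hb hc hab hbc ↦ by
      rw [h.symm, h.row_eq (hk a ha) (hk b hb) hab, h.symm, hbc])
    (by
      intro v hv
      by_contra! hne
      have hz : ∀ i j, i ≠ j → M (v i) (v j) = 0 := by
        intro i j hij
        by_cases hvij : v i = v j
        · exact absurd (by rw [hvij, hone _ (hv j)]) (hne i j hij)
        · exact (h.offdiag _ _ hvij).resolve_right (hne i j hij)
      -- Four pairwise unrelated vertices would give the form the value `3 + 4 - 8 = -1`.
      have := h.form_nonneg ![a₀, v 0, v 1, v 2, v 3] ![1, -1, -1, -1, -1]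
      simp [Fin.sum_univ_succ, h.diag, hk0, hk _ (hv _), h.symm _ a₀, hadj _ (hv _), hz] at this
      norm_num at this)
  obtain ⟨g, hg⟩ : ∃ g : Matrix α (Fin 3) ℝ,
      ∀ a i, g a i = if a = a₀ then 1 else if f a = i then 1 else 0 := ⟨_, fun _ _ ↦ rfl⟩
  have hM : M = g * gᵀ := by
    ext a b
    simp only [mul_apply, transpose_apply, hg]
    by_cases ha : a = a₀ <;> by_cases hb : b = a₀
    · subst ha hb
      simp [h.diag, hk0]; norm_num
    · simp [ha, hb, hadj]
    · simp [ha, hb, hadj, h.symm a]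
    · by_cases hab : f a = f b
      · simp [ha, hb, hab, (hf a b ha hb).2]
      · have h1 := mt (hf a b ha hb).1 hab
        have h2 : a ≠ b := fun h ↦ hab (by rw [h])
        simp [ha, hb, hab, (h.offdiag a b h2).resolve_right h1]
  obtain ⟨t, ht⟩ : ∃ t : Fin 3 → ℕ,
      ∀ i, t i = (Finset.univ.filter fun a ↦ a ≠ a₀ ∧ f a = i).card := ⟨_, fun _ ↦ rfl⟩
  have hgg : ∀ i j, (gᵀ * g) i j = (if i = j then (t i : ℝ) else 0) + 1 := by
    intro i j
    have hterm : ∀ a, gᵀ i a * g a j = (if i = j then if a ≠ a₀ ∧ f a = i then (1 : ℝ) else 0 else 0)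
        + if a = a₀ then 1 else 0 := by
      intro a
      simp only [transpose_apply, hg]
      by_cases ha : a = a₀
      · simp [ha]
      · by_cases hi : f a = i
        · simp [ha, hi]
        · simp [ha, hi]
    rw [mul_apply, Finset.sum_congr rfl fun a _ ↦ hterm a, Finset.sum_add_distrib]
    congr 1
    · by_cases hij : i = j
      · simp only [if_pos hij, ht, Finset.cast_card, Finset.sum_filter]
      · simp [hij]
    · simp
  have hN : gᵀ * g = !![(t 0 : ℝ) + 1, 1, 1; 1, t 1 + 1, 1; 1, 1, t 2 + 1] := by
    ext i j
    rw [hgg]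
    fin_cases i <;> fin_cases j <;> simp
  by_contra! hne
  obtain ⟨a, ha⟩ := hne
  have hta : 0 < t (f a) := by
    rw [ht]
    exact Finset.card_pos.2 ⟨a, by simp [ha]⟩
  obtain ⟨y, hy, hy0⟩ := cubicComplete_root (s₁ := t 0 + 1) (s₂ := t 1 + 1) (s₃ := t 2 + 1)
    (by omega) (by omega) (by omega) (by
      rintro ⟨h0, h1, h2⟩
      generalize f a = i at hta
      fin_cases i <;> simp at hta <;> omega)
  obtain ⟨x, hx, hMx⟩ := exists_eigenvector_of_cubicComplete hN hy.1.ne' hy0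
  exact h.not_betweenSquares hcard hx (hM ▸ hMx) hy

/-- By connectedness the two special vertices have a common neighbour `c`. A kernel vector then
shows that they have the same other neighbours, so `e_{a₀} - e_{b₀}` is an eigenvector of `M` for
`2`, giving the irrational `l = √3`. -/
theorem form_special_pair_eq_zero (h : IntegralCover M H k) {a₀ b₀ : α} (hab : a₀ ≠ b₀)
    (ha : k a₀ = 1) (hb : k b₀ = 1) (hk : ∀ c, c ≠ a₀ → c ≠ b₀ → k c = 0)
    (h0 : M a₀ b₀ = 0) : False := by
  have hsum : ∑ a, k a = 2 := by
    rw [Fintype.sum_eq_add a₀ b₀ hab fun c hc ↦ hk c hc.1 hc.2, ha, hb]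
  have hcard : H.edgeFinset.card = 0 := by have := h.count; omega
  obtain ⟨c, hca, hcb, hac, hbc⟩ : ∃ c, c ≠ a₀ ∧ c ≠ b₀ ∧ M a₀ c = 1 ∧ M b₀ c = 1 := by
    by_contra! hno
    have := h.conn (fun c ↦ c = a₀ ∨ (c ≠ b₀ ∧ M a₀ c = 1)) ⟨a₀, .inl rfl⟩ (by
      intro c d hc hcd
      by_cases hda : d = a₀
      · exact .inl hda
      refine .inr ?_
      by_cases hca : c = a₀
      · subst hca
        have h1 := h.entry_eq_one (Ne.symm hda) hcd
        refine ⟨?_, h1⟩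
        rintro rfl
        rw [h1] at h0
        exact one_ne_zero h0
      · obtain ⟨hcb, hac⟩ := hc.resolve_left hca
        by_cases hcd' : c = d
        · subst hcd'; exact ⟨hcb, hac⟩
        have h1 := h.entry_eq_one hcd' hcd
        by_cases hdb : d = b₀
        · subst hdb
          exact absurd (by rw [h.symm, h1]) (hno c hca hcb hac)
        · exact ⟨hdb, by rw [← h.row_eq (hk c hca hcb) (hk d hda hdb) h1, hac]⟩) b₀
    rcases this with h1 | h1
    · exact hab h1.symm
    · exact h1.1 rfl
  -- The form is `2 + 2 + 4 - 8 = 0` here, so every row satisfies `M d a₀ + M d b₀ = 2 * M d c`.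
  have hnull := h.null_of_form_eq_zero ![a₀, b₀, c] ![1, 1, -2] (by
    simp [Fin.sum_univ_succ, h.diag, ha, hb, hk c hca hcb, h0, h.symm b₀ a₀, h.symm c a₀,
      h.symm c b₀, hac, hbc]
    norm_num)
  simp only [Fin.sum_univ_succ] at hnull
  simp at hnull
  have hall : ∀ d, d ≠ a₀ → d ≠ b₀ → M d a₀ = M d b₀ := by
    intro d hda hdb
    have hd := hnull d
    by_cases hdc : d = c
    · subst hdc; rw [h.symm, hac, h.symm, hbc]
    rcases h.offdiag d a₀ hda with h1 | h1 <;> rcases h.offdiag d b₀ hdb with h2 | h2 <;>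
      rcases h.offdiag d c hdc with h3 | h3 <;> rw [h1, h2, h3] at hd <;> norm_num at hd
    · rw [h1, h2]
    · rw [h1, h2]
  refine h.not_betweenSquares hcard (y := 2) (x := ∑ i, Pi.single (![a₀, b₀] i) (![1, -1] i)) ?_ ?_
    ⟨by norm_num, 1, by norm_num, by norm_num⟩
  · intro h1
    have := congrFun h1 a₀
    simp [Fin.sum_univ_succ, Pi.single_apply, hab] at this
  · ext d
    rw [mulVec_sum_single]
    simp only [Fin.sum_univ_succ]
    simp only [Pi.smul_apply, Finset.univ_eq_empty, Finset.sum_empty, Pi.add_apply]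
    by_cases hda : d = a₀
    · subst hda
      simp [h.diag, ha, h0, hab]
      norm_num
    by_cases hdb : d = b₀
    · subst hdb
      simp [h.diag, hb, h0, h.symm d a₀, hab]
      norm_num
    · simp [hda, hdb, hall d hda hdb]

/-- Now `M a₀ b₀ = 1`, and an ordinary vertex is joined to `a₀` only, to both, or to `b₀` only. Each
type is a single cluster, so `M = g gᵀ` with rows `(1, 1, 0)` and `(0, 1, 1)` for the special
vertices. The Gram matrix is tridiagonal and `cubicPath_root` applies for all cluster sizes. -/
theorem special_pair_false (h : IntegralCover M H k) {a₀ b₀ : α} (hab : a₀ ≠ b₀)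
    (ha : k a₀ = 1) (hb : k b₀ = 1) (hk : ∀ c, c ≠ a₀ → c ≠ b₀ → k c = 0) : False := by
  have hsum : ∑ a, k a = 2 := by
    rw [Fintype.sum_eq_add a₀ b₀ hab fun c hc ↦ hk c hc.1 hc.2, ha, hb]
  have hcard : H.edgeFinset.card = 0 := by have := h.count; omega
  have hM0 : M a₀ b₀ = 1 :=
    (h.offdiag a₀ b₀ hab).resolve_left fun h0 ↦ h.form_special_pair_eq_zero hab ha hb hk h0
  have hadj : ∀ c, c ≠ a₀ → c ≠ b₀ → M a₀ c = 1 ∨ M b₀ c = 1 := by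
    suffices ∀ c, c = a₀ ∨ c = b₀ ∨ M a₀ c = 1 ∨ M b₀ c = 1 from
      fun c h1 h2 ↦ ((this c).resolve_left h1).resolve_left h2
    refine h.conn _ ⟨a₀, .inl rfl⟩ fun c d hc hcd ↦ ?_
    by_cases hda : d = a₀
    · exact .inl hda
    by_cases hdb : d = b₀
    · exact .inr (.inl hdb)
    refine .inr (.inr ?_)
    by_cases hcd' : c = d
    · subst hcd'; tauto
    have h1 := h.entry_eq_one hcd' hcd
    by_cases hca : c = a₀
    · subst hca; exact .inl h1
    by_cases hcb : c = b₀
    · subst hcb; exact .inr h1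
    have hrow := h.row_eq (hk c hca hcb) (hk d hda hdb) h1
    rw [← hrow, ← hrow]
    tauto
  have hone : ∀ c, c ≠ a₀ → c ≠ b₀ → M c c = 1 := fun c h1 h2 ↦ by simp [h.diag, hk c h1 h2]
  have hba : M b₀ a₀ = 1 := by rw [h.symm, hM0]
  have hsame : ∀ c d, c ≠ a₀ → c ≠ b₀ → d ≠ a₀ → d ≠ b₀ →
      (M c d = 1 ↔ M a₀ c = M a₀ d ∧ M b₀ c = M b₀ d) := by
    intro c d hca hcb hda hdb
    refine ⟨fun h1 ↦ ?_, fun ⟨h1, h2⟩ ↦ ?_⟩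
    · have hrow := h.row_eq (hk c hca hcb) (hk d hda hdb) h1
      exact ⟨hrow a₀, hrow b₀⟩
    · by_cases hcd : c = d
      · subst hcd; exact hone c hca hcb
      refine h.entry_eq_one hcd fun h0 ↦ ?_
      rcases hadj c hca hcb with h3 | h3
      -- If `M c d = 0`, this vector is in the kernel, and the row of `b₀` reads `1 = 2 * M b₀ c`,
      -- impossible for an entry 0 or 1.
      · have hn := h.null_of_form_eq_zero ![a₀, c, d] ![1, -1, -1] (by
          simp [Fin.sum_univ_succ, h.diag, ha, hk c hca hcb, hk d hda hdb, h.symm c a₀,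
            h.symm d a₀, h.symm d c, ← h1, h3, h0]) b₀
        simp [Fin.sum_univ_succ, hba, ← h2] at hn
        rcases h.offdiag b₀ c (Ne.symm hcb) with h4 | h4 <;> rw [h4] at hn <;> norm_num at hn
      · have hn := h.null_of_form_eq_zero ![b₀, c, d] ![1, -1, -1] (by
          simp [Fin.sum_univ_succ, h.diag, hb, hk c hca hcb, hk d hda hdb, h.symm c b₀,
            h.symm d b₀, h.symm d c, ← h2, h3, h0]) a₀
        simp [Fin.sum_univ_succ, hM0, ← h1] at hn
        rcases h.offdiag a₀ c (Ne.symm hca) with h4 | h4 <;> rw [h4] at hn <;> norm_num at hn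
  obtain ⟨f, hf0, hf1, hf2⟩ : ∃ f : α → Fin 3, (∀ c, c ≠ a₀ → c ≠ b₀ → f c = 0 →
        M a₀ c = 1 ∧ M b₀ c = 0) ∧ (∀ c, c ≠ a₀ → c ≠ b₀ → f c = 1 → M a₀ c = 1 ∧ M b₀ c = 1) ∧
      (∀ c, c ≠ a₀ → c ≠ b₀ → f c = 2 → M a₀ c = 0 ∧ M b₀ c = 1) := by
    refine ⟨fun c ↦ if M a₀ c = 0 then 2 else if M b₀ c = 0 then 0 else 1, ?_, ?_, ?_⟩ <;>
    · intro c hca hcb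
      have hadjc := hadj c hca hcb
      rcases h.offdiag a₀ c (Ne.symm hca) with h1 | h1 <;>
        rcases h.offdiag b₀ c (Ne.symm hcb) with h2 | h2 <;> simp [h1, h2] at hadjc ⊢
  obtain ⟨g, hg⟩ : ∃ g : Matrix α (Fin 3) ℝ, ∀ a i, g a i = if a = a₀ then ![1, 1, 0] i else
      if a = b₀ then ![0, 1, 1] i else if f a = i then 1 else 0 := ⟨_, fun _ _ ↦ rfl⟩
  have hfc : ∀ i : Fin 3, i = 0 ∨ i = 1 ∨ i = 2 := by decide
  have hM : M = g * gᵀ := by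
    have hspec : ∀ c, c ≠ a₀ → c ≠ b₀ →
        M a₀ c = ![1, 1, 0] (f c) ∧ M b₀ c = ![0, 1, 1] (f c) := by
      intro c hca hcb
      rcases hfc (f c) with h1 | h1 | h1
      · simpa [h1] using hf0 c hca hcb h1
      · simpa [h1] using hf1 c hca hcb h1
      · simpa [h1] using hf2 c hca hcb h1
    have hsum1 : ∀ c, c ≠ a₀ → c ≠ b₀ → ∀ w : Fin 3 → ℝ, ∑ i, w i * g c i = w (f c) := by
      intro c hca hcb w
      simp [hg, hca, hcb]
    ext a b
    simp only [mul_apply, transpose_apply]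
    by_cases hba' : b ≠ a₀ ∧ b ≠ b₀
    · rw [hsum1 b hba'.1 hba'.2]
      by_cases h1 : a = a₀
      · rw [h1, (hspec b hba'.1 hba'.2).1, hg, if_pos rfl]
      by_cases h2 : a = b₀
      · rw [h2, (hspec b hba'.1 hba'.2).2, hg, if_neg hab.symm, if_pos rfl]
      rw [hg, if_neg h1, if_neg h2]
      have hs := hsame a b h1 h2 hba'.1 hba'.2
      obtain ⟨e1, e2⟩ := hspec a h1 h2
      obtain ⟨e3, e4⟩ := hspec b hba'.1 hba'.2
      rw [e1, e2, e3, e4] at hs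
      by_cases hfab : f a = f b
      · rw [if_pos hfab, hs, hfab]
        exact ⟨rfl, rfl⟩
      · rw [if_neg hfab]
        refine (h.offdiag a b fun h ↦ hfab (by rw [h])).resolve_right fun h1 ↦ hfab ?_
        have := hs.1 h1
        generalize f a = i at this
        generalize f b = j at this
        rcases hfc i with rfl | rfl | rfl <;> rcases hfc j with rfl | rfl | rfl <;>
          simp at this <;> rfl
    by_cases haa : a ≠ a₀ ∧ a ≠ b₀
    · simp_rw [mul_comm (g a _)]
      rw [hsum1 a haa.1 haa.2, h.symm]
      by_cases h1 : b = a₀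
      · rw [h1, (hspec a haa.1 haa.2).1, hg, if_pos rfl]
      · have h2 : b = b₀ := by tauto
        rw [h2, (hspec a haa.1 haa.2).2, hg, if_neg hab.symm, if_pos rfl]
    have ha' : a = a₀ ∨ a = b₀ := by tauto
    have hb' : b = a₀ ∨ b = b₀ := by tauto
    rcases ha' with rfl | rfl <;> rcases hb' with rfl | rfl <;>
      simp [Fin.sum_univ_succ, hg, h.diag, ha, hb, hM0, hba, hab.symm]
  obtain ⟨t, ht⟩ : ∃ t : Fin 3 → ℕ,
      ∀ i, t i = (Finset.univ.filter fun a ↦ (a ≠ a₀ ∧ a ≠ b₀) ∧ f a = i).card :=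
    ⟨_, fun _ ↦ rfl⟩
  have hgg : ∀ i j, (gᵀ * g) i j = (if i = j then (t i : ℝ) else 0) +
      (![1, 1, 0] i * ![1, 1, 0] j + ![0, 1, 1] i * ![0, 1, 1] j) := by
    intro i j
    have hterm : ∀ a, gᵀ i a * g a j =
        (if i = j then if (a ≠ a₀ ∧ a ≠ b₀) ∧ f a = i then (1 : ℝ) else 0 else 0) +
        ((if a = a₀ then ![1, 1, 0] i * ![1, 1, 0] j else 0) +
          if a = b₀ then ![0, 1, 1] i * ![0, 1, 1] j else 0) := by
      intro a
      simp only [transpose_apply, hg]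
      by_cases h1 : a = a₀
      · simp [h1, hab]
      by_cases h2 : a = b₀
      · simp [h2, hab.symm]
      by_cases hi : f a = i
      · simp [h1, h2, hi]
      · simp [h1, h2, hi]
    rw [mul_apply, Finset.sum_congr rfl fun a _ ↦ hterm a, Finset.sum_add_distrib,
      Finset.sum_add_distrib]
    congr 1
    · by_cases hij : i = j
      · simp only [if_pos hij, ht, Finset.cast_card, Finset.sum_filter]
      · simp [hij]
    · simp
  have hN : gᵀ * g = !![(t 0 : ℝ) + 1, 1, 0; 1, t 1 + 2, 1; 0, 1, t 2 + 1] := by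
    ext i j
    rw [hgg]
    fin_cases i <;> fin_cases j <;> simp <;> norm_num
  obtain ⟨y, hy, hy0⟩ := cubicPath_root (s₁ := t 0 + 1) (s₂ := t 1 + 2) (s₃ := t 2 + 1)
    (by omega) (by omega)
  obtain ⟨x, hx, hMx⟩ := exists_eigenvector_of_cubicPath hN hy.1.ne' hy0
  exact h.not_betweenSquares hcard hx (hM ▸ hMx) hy

theorem exists_unique_special (h : IntegralCover M H k) : ∃ a₀, k a₀ = 2 ∧ ∀ a, a = a₀ := by
  obtain ⟨a₀, ha₀⟩ := h.exists_special
  have hle : k a₀ + ∑ a ∈ Finset.univ.erase a₀, k a ≤ 2 := by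
    rw [Finset.add_sum_erase _ _ (Finset.mem_univ a₀)]
    have := h.count; omega
  by_cases hrest : ∑ a ∈ Finset.univ.erase a₀, k a = 0
  · have hk : ∀ a, a ≠ a₀ → k a = 0 := fun a ha ↦
      Finset.sum_eq_zero_iff.1 hrest a (Finset.mem_erase.2 ⟨ha, Finset.mem_univ a⟩)
    have := h.special_ne_one_of_unique hk
    have hk2 : k a₀ = 2 := by omega
    exact ⟨a₀, hk2, h.eq_special_of_unique hk2 hk⟩
  · obtain ⟨b₀, hb₀, hb⟩ := Finset.exists_ne_zero_of_sum_ne_zero hrest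
    rw [← Finset.add_sum_erase _ _ hb₀] at hle
    have hrest' : ∑ a ∈ (Finset.univ.erase a₀).erase b₀, k a = 0 := by omega
    refine (h.special_pair_false (a₀ := a₀) (b₀ := b₀) (Finset.ne_of_mem_erase hb₀).symm
      (by omega) (by omega) fun c hca hcb ↦ ?_).elim
    exact Finset.sum_eq_zero_iff.1 hrest' c (by simp [hca, hcb])

end IntegralCover

/-! ### Spectral coordinates and isotropic subspaces -/

theorem isRoot_charpoly_of_mulVec_eq_smul {n : Type*} [Fintype n] [DecidableEq n]
    {K : Matrix n n ℝ} {l : ℝ} {u : n → ℝ} (hu : u ≠ 0) (h : K *ᵥ u = l • u) :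
    K.charpoly.IsRoot l := by
  rw [Polynomial.IsRoot, eval_charpoly]
  refine exists_mulVec_eq_zero_iff.1 ⟨u, hu, ?_⟩
  rw [sub_mulVec, h, sub_eq_zero]
  ext i
  simp [Matrix.scalar_apply, mulVec_diagonal]

theorem exists_spectral_decomposition {n : Type*} [Fintype n] [DecidableEq n]
    {K : Matrix n n ℝ} (hK : K.IsHermitian) :
    ∃ (W : Matrix n n ℝ) (c : n → ℝ), Wᵀ * W = 1 ∧ K = Wᵀ * diagonal c * W ∧
      (∀ i, K.charpoly.IsRoot (c i)) ∧ K.rank = (Finset.univ.filter fun i ↦ c i ≠ 0).card := by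
  refine ⟨(hK.eigenvectorUnitary : Matrix n n ℝ)ᵀ, hK.eigenvalues, ?_, ?_, ?_, ?_⟩
  · have := Unitary.mul_star_self_of_mem hK.eigenvectorUnitary.2
    rw [star_eq_conjTranspose, conjTranspose_eq_transpose_of_trivial] at this
    rwa [transpose_transpose]
  · have := hK.spectral_theorem
    rw [Unitary.conjStarAlgAut_apply] at this
    rw [transpose_transpose]
    simpa [star_eq_conjTranspose, conjTranspose_eq_transpose_of_trivial, Function.comp_def]
      using this
  · intro i
    rw [hK.charpoly_eq, Polynomial.IsRoot, Polynomial.eval_prod]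
    exact Finset.prod_eq_zero (Finset.mem_univ i) (by simp)
  · rw [hK.rank_eq_card_non_zero_eigs, Fintype.card_subtype]

theorem exists_ne_zero_coordinates_eq_zero {n E : Type*} [Fintype n]
    [AddCommGroup E] [Module ℝ E] [FiniteDimensional ℝ E] (f : E →ₗ[ℝ] n → ℝ) (W : Matrix n n ℝ)
    (I : Finset n) (hI : I.card < Module.finrank ℝ E) :
    ∃ e ≠ 0, ∀ i ∈ I, (W *ᵥ f e) i = 0 := by
  let φ : E →ₗ[ℝ] (I → ℝ) := LinearMap.funLeft ℝ ℝ (Subtype.val : I → n) ∘ₗ W.mulVecLin ∘ₗ f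
  have hker : LinearMap.ker φ ≠ ⊥ := LinearMap.ker_ne_bot_of_finrank_lt (by simpa using hI)
  obtain ⟨e, he, he0⟩ := Submodule.exists_mem_ne_zero_of_ne_bot hker
  exact ⟨e, he0, fun i hi ↦ congrFun (LinearMap.mem_ker.1 he) ⟨i, hi⟩⟩

section Spectral

variable {n : Type*} [Fintype n] [DecidableEq n] {K W : Matrix n n ℝ} {c : n → ℝ}

theorem dotProduct_self_eq_sum_coordinates (hW : Wᵀ * W = 1) (u : n → ℝ) :
    u ⬝ᵥ u = ∑ i, (W *ᵥ u) i ^ 2 := by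
  calc u ⬝ᵥ u = u ⬝ᵥ ((Wᵀ * W) *ᵥ u) := by rw [hW, one_mulVec]
    _ = (W *ᵥ u) ⬝ᵥ (W *ᵥ u) := by
      rw [← mulVec_mulVec, dotProduct_mulVec, vecMul_transpose]
    _ = _ := by simp [dotProduct, sq]

theorem dotProduct_mulVec_eq_sum_coordinates (hK : K = Wᵀ * diagonal c * W) (u : n → ℝ) :
    u ⬝ᵥ (K *ᵥ u) = ∑ i, c i * (W *ᵥ u) i ^ 2 := by
  calc u ⬝ᵥ (K *ᵥ u) = (W *ᵥ u) ⬝ᵥ (diagonal c *ᵥ (W *ᵥ u)) := by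
        rw [hK, mul_assoc, ← mulVec_mulVec, dotProduct_mulVec, vecMul_transpose, ← mulVec_mulVec]
    _ = _ := by
      simp only [dotProduct, mulVec_diagonal]
      exact Finset.sum_congr rfl fun i _ ↦ by ring

/-- A subspace on which the quadratic form vanishes has dimension at most the number of indices
outside the part of the spectrum where `s * c i` is positive. -/
theorem finrank_le_card_of_isotropic (hW : Wᵀ * W = 1) (hK : K = Wᵀ * diagonal c * W)
    {E : Type*} [AddCommGroup E] [Module ℝ E] [FiniteDimensional ℝ E] {f : E →ₗ[ℝ] n → ℝ}
    (hf : Function.Injective f) (h0 : ∀ e, f e ⬝ᵥ (K *ᵥ f e) = 0) (s : ℝ) :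
    Module.finrank ℝ E ≤ (Finset.univ.filter fun i ↦ ¬ 0 < s * c i).card := by
  by_contra! hlt
  obtain ⟨e, he0, he⟩ := exists_ne_zero_coordinates_eq_zero f W _ hlt
  have h1 := h0 e
  rw [dotProduct_mulVec_eq_sum_coordinates hK] at h1
  have h2 : ∑ i, (s * c i) * (W *ᵥ f e) i ^ 2 = 0 := by
    simp_rw [mul_assoc, ← Finset.mul_sum, h1, mul_zero]
  have h3 : ∀ i, (W *ᵥ f e) i = 0 := by
    rw [Finset.sum_eq_zero_iff_of_nonneg] at h2
    · intro i
      by_cases hi : 0 < s * c i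
      · have := (mul_eq_zero.1 (h2 i (Finset.mem_univ i))).resolve_left hi.ne'
        exact pow_eq_zero_iff (two_ne_zero) |>.1 this
      · exact he i (by simpa using hi)
    · intro i _
      by_cases hi : 0 < s * c i
      · positivity
      · rw [he i (by simpa using hi)]; simp
  apply he0
  apply hf
  rw [map_zero, ← dotProduct_self_eq_zero, dotProduct_self_eq_sum_coordinates hW]
  simp [h3]

end Spectral

/-! ### Block matrices with a zero diagonal block -/

section Blocks

variable {α δ : Type*} [Fintype α] [Fintype δ] {S : Matrix α α ℝ} {B : Matrix α δ ℝ}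

theorem dotProduct_fromBlocks_mulVec (a : α → ℝ) (d : δ → ℝ) :
    Sum.elim a d ⬝ᵥ (fromBlocks S B Bᵀ 0 *ᵥ Sum.elim a d) = a ⬝ᵥ (S *ᵥ a) + 2 * (d ⬝ᵥ (Bᵀ *ᵥ a)) := by
  rw [fromBlocks_mulVec]
  simp only [Sum.elim_comp_inl, Sum.elim_comp_inr, sumElim_dotProduct_sumElim, zero_mulVec, add_zero,
    dotProduct_add]
  rw [dotProduct_mulVec a B, mulVec_transpose, dotProduct_comm (a ᵥ* B)]
  ring

variable [DecidableEq α] [DecidableEq δ]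

/-- The isotropic space of vectors supported on `δ` allows at most `|α|` eigenvalues of each sign,
so the rank bound is attained and exactly `|δ|` eigenvalues are nonpositive. The positive ones are
at least 1, so a space on which `K - 1` is negative definite has dimension at most `|δ|`; a negative
direction of the Schur complement would give one of dimension `|δ| + 1`. -/
theorem rank_and_posSemidef_of_blocks (hS : S.IsHermitian)
    (hint : ∀ x : ℝ, (fromBlocks S B Bᵀ 0).charpoly.IsRoot x → ∃ k : ℤ, x = k)
    (hrank : 2 * Fintype.card α ≤ (fromBlocks S B Bᵀ 0).rank) :
    (fromBlocks S B Bᵀ 0).rank = 2 * Fintype.card α ∧ (S + B * Bᵀ - 1).PosSemidef := by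
  have hK : (fromBlocks S B Bᵀ (0 : Matrix δ δ ℝ)).IsHermitian := by
    refine hS.fromBlocks ?_ isHermitian_zero
    rw [conjTranspose_eq_transpose_of_trivial]
  obtain ⟨W, c, hW, hKW, hroot, hr⟩ := exists_spectral_decomposition hK
  let f₁ : (δ → ℝ) →ₗ[ℝ] (α ⊕ δ → ℝ) :=
    { toFun := fun y ↦ Sum.elim 0 y
      map_add' := fun x y ↦ by ext (i | i) <;> simp
      map_smul' := fun r y ↦ by ext (i | i) <;> simp }
  have hf₁ : Function.Injective f₁ := by
    intro x y h
    ext i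
    exact congrFun h (Sum.inr i)
  have h0 : ∀ y, f₁ y ⬝ᵥ (fromBlocks S B Bᵀ 0 *ᵥ f₁ y) = 0 := by
    intro y
    change Sum.elim 0 y ⬝ᵥ _ *ᵥ Sum.elim 0 y = _
    rw [dotProduct_fromBlocks_mulVec]
    simp
  have hp := finrank_le_card_of_isotropic hW hKW hf₁ h0 1
  have hq := finrank_le_card_of_isotropic hW hKW hf₁ h0 (-1)
  simp only [Module.finrank_fintype_fun_eq_card, one_mul, neg_one_mul] at hp hq
  have hp' := Finset.card_filter_add_card_filter_not (s := Finset.univ) (fun i ↦ 0 < c i)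
  have hq' := Finset.card_filter_add_card_filter_not (s := Finset.univ) (fun i ↦ 0 < - c i)
  have hpq : (Finset.univ.filter fun i ↦ c i ≠ 0).card =
      (Finset.univ.filter fun i ↦ 0 < c i).card + (Finset.univ.filter fun i ↦ 0 < - c i).card := by
    rw [← Finset.card_union_of_disjoint]
    · congr 1
      ext i
      simp only [Finset.mem_filter, Finset.mem_univ, true_and, Finset.mem_union, Left.neg_pos_iff]
      rw [or_comm]
      exact ne_iff_lt_or_gt
    · rw [Finset.disjoint_filter]
      intro i _ h1 h2
      linarith
  simp only [Finset.card_univ, Fintype.card_sum] at hp' hq'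
  have hpos : (Finset.univ.filter fun i ↦ ¬ 0 < c i).card = Fintype.card δ := by omega
  refine ⟨by omega, ?_⟩
  have hone : ∀ i, 0 < c i → 1 ≤ c i := by
    intro i hi
    obtain ⟨k, hk⟩ := hint _ (hroot i)
    rw [hk] at hi ⊢
    have : 0 < k := by exact_mod_cast hi
    exact_mod_cast this
  refine PosSemidef.of_dotProduct_mulVec_nonneg ?_ fun x ↦ ?_
  · refine (hS.add ?_).sub isHermitian_one
    simpa [conjTranspose_eq_transpose_of_trivial] using isHermitian_mul_conjTranspose_self B
  rw [star_trivial]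
  by_contra! hx
  -- Completing the square: on the image of `(y, s)` the form of `K - 1` equals `s² * (x ⬝ᵥ M *ᵥ x)
  -- - y ⬝ᵥ y`, with `M = S + B * Bᵀ - 1`.
  let f₂ : (δ → ℝ) × ℝ →ₗ[ℝ] (α ⊕ δ → ℝ) :=
    { toFun := fun y ↦ Sum.elim (y.2 • x) (y.1 + Bᵀ *ᵥ (y.2 • x))
      map_add' := fun y z ↦ by
        ext (i | i)
        · simp [add_mul]
        · simp [add_smul, mulVec_add]; ring
      map_smul' := fun r y ↦ by
        ext (i | i)
        · simp [mul_assoc]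
        · simp [mul_smul, mulVec_smul]; ring }
  obtain ⟨⟨y, s⟩, he0, he⟩ := exists_ne_zero_coordinates_eq_zero f₂ W
    (Finset.univ.filter fun i ↦ ¬ 0 < c i) (by rw [hpos]; simp)
  have hform : f₂ (y, s) ⬝ᵥ f₂ (y, s) ≤
      f₂ (y, s) ⬝ᵥ (fromBlocks S B Bᵀ 0 *ᵥ f₂ (y, s)) := by
    rw [dotProduct_self_eq_sum_coordinates hW, dotProduct_mulVec_eq_sum_coordinates hKW]
    refine Finset.sum_le_sum fun i _ ↦ ?_
    by_cases hi : 0 < c i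
    · nlinarith [hone i hi, sq_nonneg ((W *ᵥ f₂ (y, s)) i)]
    · rw [he i (by simpa using hi)]; simp
  change Sum.elim (s • x) (y + Bᵀ *ᵥ (s • x)) ⬝ᵥ Sum.elim (s • x) (y + Bᵀ *ᵥ (s • x)) ≤
    Sum.elim (s • x) (y + Bᵀ *ᵥ (s • x)) ⬝ᵥ
      (fromBlocks S B Bᵀ 0 *ᵥ Sum.elim (s • x) (y + Bᵀ *ᵥ (s • x))) at hform
  rw [dotProduct_fromBlocks_mulVec, sumElim_dotProduct_sumElim] at hform
  have hM : (s • x) ⬝ᵥ ((S + B * Bᵀ - 1) *ᵥ (s • x)) = s ^ 2 * (x ⬝ᵥ (S + B * Bᵀ - 1) *ᵥ x) := by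
    rw [mulVec_smul, smul_dotProduct, dotProduct_smul]
    simp only [smul_eq_mul]; ring
  have hM' : (s • x) ⬝ᵥ ((S + B * Bᵀ - 1) *ᵥ (s • x)) = (s • x) ⬝ᵥ (S *ᵥ (s • x)) +
      (Bᵀ *ᵥ (s • x)) ⬝ᵥ (Bᵀ *ᵥ (s • x)) - (s • x) ⬝ᵥ (s • x) := by
    rw [sub_mulVec, add_mulVec, one_mulVec, dotProduct_sub, dotProduct_add, ← mulVec_mulVec,
      dotProduct_mulVec (s • x) B, ← mulVec_transpose B]
  generalize s • x = a at *
  simp only [add_dotProduct, dotProduct_add] at hform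
  rw [dotProduct_comm (Bᵀ *ᵥ a) y] at hform
  have hy : 0 ≤ y ⬝ᵥ y := Finset.sum_nonneg fun i _ ↦ mul_self_nonneg _
  have hs : s = 0 := by
    by_contra hs
    have : s ^ 2 * (x ⬝ᵥ (S + B * Bᵀ - 1) *ᵥ x) < 0 := mul_neg_of_pos_of_neg (by positivity) hx
    linarith
  have hy0 : y ⬝ᵥ y ≤ 0 := by
    rw [hs] at hM
    linarith
  apply he0
  rw [hs, dotProduct_self_eq_zero.1 (le_antisymm hy0 hy)]
  rfl

/-- The lower block of the eigenvalue equation determines the coordinates on `δ` as `l⁻¹ • (Bᵀ *ᵥ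
x)`; substituted in the upper block and multiplied by `l`, it becomes `h`. -/
theorem isRoot_charpoly_of_blocks {l : ℝ} (hl : 0 < l) {x : α → ℝ} (hx : x ≠ 0)
    (h : (S + B * Bᵀ - 1) *ᵥ x = (l ^ 2 - 1) • x - (l - 1) • (S *ᵥ x)) :
    (fromBlocks S B Bᵀ 0).charpoly.IsRoot l := by
  refine isRoot_charpoly_of_mulVec_eq_smul (u := Sum.elim x (l⁻¹ • (Bᵀ *ᵥ x)))
    (fun h ↦ hx (funext fun i ↦ congrFun h (Sum.inl i))) ?_
  rw [sub_mulVec, add_mulVec, one_mulVec, ← mulVec_mulVec] at h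
  rw [fromBlocks_mulVec]
  ext (i | i)
  · have hi := congrFun h i
    simp only [Pi.sub_apply, Pi.add_apply, Pi.smul_apply, smul_eq_mul] at hi
    simp [mulVec_smul, -mulVec_mulVec]
    field_simp
    linear_combination hi
  · simp
    field_simp

end Blocks

/-! ### Trees: leaves, kernels and small vertex covers -/

namespace SimpleGraph

theorem IsTree.eq_of_adj_of_dist {V : Type*} {T : SimpleGraph V} (hT : T.IsTree) {r u u' v : V}
    (hu : T.Adj u v) (hu' : T.Adj u' v) (hd : T.dist r v = T.dist r u + 1)
    (hd' : T.dist r v = T.dist r u' + 1) : u = u' := by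
  obtain ⟨p, hp⟩ := hT.1.exists_walk_length_eq_dist r u
  obtain ⟨p', hp'⟩ := hT.1.exists_walk_length_eq_dist r u'
  have h1 : (p.concat hu).IsPath := Walk.isPath_of_length_eq_dist _ (by
    rw [Walk.length_concat, hp, hd])
  have h2 : (p'.concat hu').IsPath := Walk.isPath_of_length_eq_dist _ (by
    rw [Walk.length_concat, hp', hd'])
  have h3 := (hT.existsUnique_path r v).unique h1 h2
  have h4 := congrArg Walk.penultimate h3
  rwa [Walk.penultimate_concat, Walk.penultimate_concat] at h4

/-- A vertex of `s` farthest from a root can only have its parent as a neighbour in `s`. -/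
theorem IsTree.exists_mem_unique_adj {V : Type*} {T : SimpleGraph V} (hT : T.IsTree)
    {s : Finset V} (hs : s.Nonempty) :
    ∃ v ∈ s, ∀ u ∈ s, ∀ u' ∈ s, T.Adj u v → T.Adj u' v → u = u' := by
  obtain ⟨r, hr⟩ := hs
  obtain ⟨v, hv, hmax⟩ := s.exists_max_image (T.dist r) ⟨r, hr⟩
  refine ⟨v, hv, fun u hu u' hu' huv huv' ↦ hT.eq_of_adj_of_dist (r := r) huv huv' ?_ ?_⟩
  · have := hT.dist_eq_dist_add_one_of_adj r huv
    have := hmax u hu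
    omega
  · have := hT.dist_eq_dist_add_one_of_adj r huv'
    have := hmax u' hu'
    omega

theorem IsTree.eq_of_two_common_adj {V : Type*} {T : SimpleGraph V} (hT : T.IsTree) {a b d d' : V}
    (hab : a ≠ b) (h1 : T.Adj a d) (h2 : T.Adj b d) (h3 : T.Adj a d') (h4 : T.Adj b d') :
    d = d' := by
  have p : ∀ x (hax : T.Adj a x) (hbx : T.Adj b x),
      (Walk.cons hax (Walk.cons hbx.symm Walk.nil)).IsPath := by
    intro x hax hbx
    simp [Walk.cons_isPath_iff, hab, hax.ne, hbx.ne']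
  have := (hT.existsUnique_path a b).unique (p d h1 h2) (p d' h3 h4)
  have := congrArg Walk.snd this
  simpa using this

section Kernel

/-- The linear map that sets the coordinate at `v` to zero. -/
def eraseCoordinate {V : Type*} [DecidableEq V] (v : V) : (V → ℝ) →ₗ[ℝ] (V → ℝ) where
  toFun x w := if w = v then 0 else x w
  map_add' x y := by ext w; by_cases h : w = v <;> simp [h]
  map_smul' r x := by ext w; by_cases h : w = v <;> simp [h]

theorem eraseCoordinate_apply {V : Type*} [DecidableEq V] (v w : V) (x : V → ℝ) :
    eraseCoordinate v x w = if w = v then 0 else x w := rfl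

variable {V : Type*} [Fintype V] (T : SimpleGraph V) [DecidableRel T.Adj]

/-- The kernel of the adjacency matrix of the subgraph induced on `s`, extended by zero. -/
def kernelOn (s : Finset V) : Submodule ℝ (V → ℝ) where
  carrier := {x | (∀ v ∉ s, x v = 0) ∧ ∀ v ∈ s, (T.adjMatrix ℝ *ᵥ x) v = 0}
  add_mem' := fun {x y} hx hy ↦ ⟨fun v hv ↦ by simp [hx.1 v hv, hy.1 v hv], fun v hv ↦ by
    rw [mulVec_add, Pi.add_apply, hx.2 v hv, hy.2 v hv, add_zero]⟩
  zero_mem' := ⟨fun v _ ↦ rfl, fun v _ ↦ by rw [mulVec_zero, Pi.zero_apply]⟩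
  smul_mem' := fun r x hx ↦ ⟨fun v hv ↦ by simp [hx.1 v hv], fun v hv ↦ by
    rw [mulVec_smul, Pi.smul_apply, hx.2 v hv, smul_zero]⟩

theorem nullity_add_rank : T.nullity + (T.adjMatrix ℝ).rank = Fintype.card V := by
  have := LinearMap.finrank_range_add_finrank_ker (T.adjMatrix ℝ).mulVecLin
  rw [Module.finrank_fintype_fun_eq_card] at this
  rw [← this, add_comm]
  rfl

variable [DecidableEq V]

theorem adjMatrix_mulVec_eraseCoordinate (v w : V) (x : V → ℝ) (h : ¬ T.Adj w v) :
    (T.adjMatrix ℝ *ᵥ eraseCoordinate v x) w = (T.adjMatrix ℝ *ᵥ x) w := by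
  simp only [adjMatrix_mulVec_apply]
  refine Finset.sum_congr rfl fun y hy ↦ if_neg ?_
  rintro rfl
  exact h (by simpa using hy)

variable {T}

theorem finrank_kernelOn_le_of_isolated {s : Finset V} {v : V}
    (hvs : ∀ u ∈ s, ¬ T.Adj u v) :
    Module.finrank ℝ (T.kernelOn s) ≤ Module.finrank ℝ (T.kernelOn (s.erase v)) + 1 := by
  have hmem : ∀ x ∈ T.kernelOn s, eraseCoordinate v x ∈ T.kernelOn (s.erase v) := by
    intro x hx
    refine ⟨fun w hw ↦ ?_, fun w hw ↦ ?_⟩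
    · rw [eraseCoordinate_apply]
      by_cases hwv : w = v
      · rw [if_pos hwv]
      · rw [if_neg hwv]
        exact hx.1 w fun h ↦ hw (Finset.mem_erase.2 ⟨hwv, h⟩)
    · have hws := Finset.mem_of_mem_erase hw
      rw [adjMatrix_mulVec_eraseCoordinate _ _ _ _ (hvs w hws)]
      exact hx.2 w hws
  have := LinearMap.finrank_le_finrank_of_injective
    (f := ((eraseCoordinate v).restrict hmem).prod
      ((LinearMap.proj v : (V → ℝ) →ₗ[ℝ] ℝ) ∘ₗ (T.kernelOn s).subtype)) (by
    rw [← LinearMap.ker_eq_bot, LinearMap.ker_eq_bot']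
    intro x hx
    obtain ⟨h1, h2⟩ := Prod.ext_iff.1 hx
    ext w
    by_cases hwv : w = v
    · rw [hwv]; exact h2
    · have := congrFun (congrArg Subtype.val h1) w
      simpa [eraseCoordinate_apply, hwv] using this)
  simpa using this

/-- The equation at the leaf `v` gives `x u = 0`, and the equation at `u` recovers `x v` from the
other coordinates. Erasing `v` is therefore injective on the kernel. -/
theorem finrank_kernelOn_le_of_leaf {s : Finset V} {u v : V} (hu : u ∈ s) (hv : v ∈ s)
    (huv : T.Adj u v) (hvs : ∀ w ∈ s, T.Adj w v → w = u) :
    Module.finrank ℝ (T.kernelOn s) ≤ Module.finrank ℝ (T.kernelOn ((s.erase v).erase u)) := by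
  have hxu : ∀ x ∈ T.kernelOn s, x u = 0 := by
    intro x hx
    have := hx.2 v hv
    rw [adjMatrix_mulVec_apply, Finset.sum_eq_single u] at this
    · exact this
    · intro w hw hwu
      exact hx.1 w fun hws ↦ hwu (hvs w hws (((T.mem_neighborFinset v w).1 hw).symm))
    · intro h
      exact absurd ((T.mem_neighborFinset v u).2 huv.symm) h
  have hmem : ∀ x ∈ T.kernelOn s, eraseCoordinate v x ∈ T.kernelOn ((s.erase v).erase u) := by
    intro x hx
    refine ⟨fun w hw ↦ ?_, fun w hw ↦ ?_⟩
    · rw [eraseCoordinate_apply]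
      by_cases hwv : w = v
      · rw [if_pos hwv]
      · rw [if_neg hwv]
        by_cases hwu : w = u
        · rw [hwu]; exact hxu x hx
        · exact hx.1 w fun h ↦ hw (by simp [h, hwu, hwv])
    · simp only [Finset.mem_erase] at hw
      rw [adjMatrix_mulVec_eraseCoordinate _ _ _ _ fun h ↦ hw.1 (hvs w hw.2.2 h)]
      exact hx.2 w hw.2.2
  refine LinearMap.finrank_le_finrank_of_injective (f := (eraseCoordinate v).restrict hmem) ?_
  rw [← LinearMap.ker_eq_bot, LinearMap.ker_eq_bot']
  intro x hx
  have hw : ∀ w, w ≠ v → x.1 w = 0 := by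
    intro w hwv
    have := congrFun (congrArg Subtype.val hx) w
    simpa [eraseCoordinate_apply, hwv] using this
  ext w
  by_cases hwv : w = v
  · have := x.2.2 u hu
    rw [adjMatrix_mulVec_apply, Finset.sum_eq_single v (fun y _ hy ↦ hw y hy)
      (fun h ↦ absurd ((T.mem_neighborFinset u v).2 huv) h)] at this
    rw [hwv]; exact this
  · exact hw w hwv

/-- Induction by removing an isolated vertex, which lowers the kernel dimension by at most one, or a
leaf together with its neighbour, which does not lower the dimension bound. In the second case the
neighbour joins the cover and meets every removed edge. -/
theorem IsTree.exists_cover_kernelOn (hT : T.IsTree) (s : Finset V) :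
    ∃ A ⊆ s, (∀ u ∈ s, ∀ v ∈ s, T.Adj u v → u ∈ A ∨ v ∈ A) ∧
      Module.finrank ℝ (T.kernelOn s) + 2 * A.card ≤ s.card := by
  induction s using Finset.strongInduction with | _ s ih
  rcases s.eq_empty_or_nonempty with rfl | hs
  · refine ⟨∅, subset_rfl, by simp, ?_⟩
    have : T.kernelOn (∅ : Finset V) = ⊥ := by
      rw [eq_bot_iff]
      intro x hx
      rw [Submodule.mem_bot]
      ext v
      exact hx.1 v (by simp)
    rw [this]
    simp
  obtain ⟨v, hv, huniq⟩ := hT.exists_mem_unique_adj hs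
  by_cases hiso : ∀ u ∈ s, ¬ T.Adj u v
  · obtain ⟨A, hAs, hcov, hA⟩ := ih _ (Finset.erase_ssubset hv)
    refine ⟨A, hAs.trans (Finset.erase_subset _ _), fun x hx y hy hxy ↦ ?_, ?_⟩
    · refine hcov x (Finset.mem_erase.2 ⟨?_, hx⟩) y (Finset.mem_erase.2 ⟨?_, hy⟩) hxy
      · rintro rfl; exact hiso y hy hxy.symm
      · rintro rfl; exact hiso x hx hxy
    · have := finrank_kernelOn_le_of_isolated hiso
      have := Finset.card_erase_add_one hv
      omega
  · push Not at hiso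
    obtain ⟨u, hu, huv⟩ := hiso
    have hu' : u ∈ s.erase v := Finset.mem_erase.2 ⟨huv.ne, hu⟩
    obtain ⟨A, hAs, hcov, hA⟩ := ih ((s.erase v).erase u)
      ((Finset.erase_ssubset hu').trans (Finset.erase_ssubset hv))
    have huA : u ∉ A := fun h ↦ by simpa using hAs h
    refine ⟨insert u A, ?_, fun x hx y hy hxy ↦ ?_, ?_⟩
    · refine Finset.insert_subset hu (hAs.trans ?_)
      exact (Finset.erase_subset _ _).trans (Finset.erase_subset _ _)
    · by_cases hxu : x = u
      · simp [hxu]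
      by_cases hyu : y = u
      · simp [hyu]
      have hxv : x ≠ v := by
        rintro rfl; exact hyu (huniq y hy u hu hxy.symm huv)
      have hyv : y ≠ v := by
        rintro rfl; exact hxu (huniq x hx u hu hxy huv)
      have := hcov x (by simp [hx, hxu, hxv]) y (by simp [hy, hyu, hyv]) hxy
      simp only [Finset.mem_insert]
      tauto
    · have := finrank_kernelOn_le_of_leaf hu hv huv fun w hw hwv ↦ huniq w hw u hu hwv huv
      have := Finset.card_erase_add_one hv
      have := Finset.card_erase_add_one hu'
      rw [Finset.card_insert_of_notMem huA]
      omega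

theorem IsTree.exists_cover (hT : T.IsTree) :
    ∃ A : Finset V, (∀ u v, T.Adj u v → u ∈ A ∨ v ∈ A) ∧
      T.nullity + 2 * A.card ≤ Fintype.card V := by
  obtain ⟨A, -, hcov, hA⟩ := hT.exists_cover_kernelOn Finset.univ
  refine ⟨A, fun u v ↦ hcov u (Finset.mem_univ u) v (Finset.mem_univ v), ?_⟩
  have : T.kernelOn Finset.univ = LinearMap.ker (T.adjMatrix ℝ).mulVecLin := by
    ext x
    rw [LinearMap.mem_ker, mulVecLin_apply]
    exact ⟨fun h ↦ funext fun v ↦ h.2 v (Finset.mem_univ v),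
      fun h ↦ ⟨fun v hv ↦ absurd (Finset.mem_univ v) hv, fun v _ ↦ congrFun h v⟩⟩
  rwa [this] at hA

end Kernel

end SimpleGraph

/-! ### The cover matrix of a tree -/

namespace SimpleGraph

theorem IsTree.common_adj_imp_not_adj {V : Type*} {T : SimpleGraph V} (hT : T.IsTree) {a b d : V} (h1 : T.Adj a d)
    (h2 : T.Adj b d) : ¬ T.Adj a b := by
  intro h3
  have e1 := hT.dist_eq_dist_add_one_of_adj a h1
  have e2 := hT.dist_eq_dist_add_one_of_adj a h2
  have e3 := hT.dist_eq_dist_add_one_of_adj a h3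
  omega

section Cover

variable {V : Type*} [Fintype V] [DecidableEq V] (T : SimpleGraph V) [DecidableRel T.Adj]
  (A : Finset V)

/-- The subgraph induced on a set of vertices. -/
abbrev coverGraph : SimpleGraph {v // v ∈ A} := T.comap Subtype.val

/-- The adjacencies between a set of vertices and its complement. -/
def coverIncidence : Matrix {v // v ∈ A} {v // v ∉ A} ℝ :=
  fun a d ↦ if T.Adj a d then 1 else 0

/-- The matrix `S + B Bᵀ - 1` for the induced adjacency matrix `S` and the incidence matrix `B`. -/
def coverMatrix : Matrix {v // v ∈ A} {v // v ∈ A} ℝ :=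
  (T.coverGraph A).adjMatrix ℝ + T.coverIncidence A * (T.coverIncidence A)ᵀ - 1

theorem reindex_adjMatrix_eq_fromBlocks {V : Type*} [DecidableEq V] {T : SimpleGraph V}
    [DecidableRel T.Adj] {A : Finset V} (hcov : ∀ u v, T.Adj u v → u ∈ A ∨ v ∈ A) :
    Matrix.reindex (Equiv.sumCompl (· ∈ A)).symm (Equiv.sumCompl (· ∈ A)).symm (T.adjMatrix ℝ) =
      fromBlocks ((T.coverGraph A).adjMatrix ℝ) (T.coverIncidence A) (T.coverIncidence A)ᵀ 0 := by
  ext (a | a) (b | b)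
  · simp [adjMatrix_apply]
  · simp [adjMatrix_apply, coverIncidence]
  · simp [adjMatrix_apply, coverIncidence, T.adj_comm]
  · simp only [reindex_apply, submatrix_apply, Equiv.symm_symm, Equiv.sumCompl_apply_inr,
      adjMatrix_apply, fromBlocks_apply₂₂, Matrix.zero_apply]
    exact if_neg fun h ↦ (hcov _ _ h).elim a.2 b.2

/-- The number of neighbours outside of `A`. -/
def outDegree (a : V) : ℕ := (Finset.univ.filter fun d : {v // v ∉ A} ↦ T.Adj a d).card

variable {T A}

theorem coverMatrix_apply (a b : {v // v ∈ A}) : T.coverMatrix A a b =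
    (if T.Adj a b then 1 else 0) +
      ((Finset.univ.filter fun d : {v // v ∉ A} ↦ T.Adj a d ∧ T.Adj b d).card : ℝ) -
      if a = b then 1 else 0 := by
  rw [coverMatrix, Matrix.sub_apply, Matrix.add_apply, adjMatrix_apply, mul_apply, one_apply,
    Finset.cast_card, Finset.sum_filter]
  simp only [transpose_apply, coverIncidence, comap_adj, mul_ite, mul_one, mul_zero]
  congr 3
  ext d
  by_cases h1 : T.Adj a d <;> by_cases h2 : T.Adj b d <;> simp [h1, h2]

theorem coverMatrix_apply_self (a : {v // v ∈ A}) :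
    T.coverMatrix A a a = (T.outDegree A a : ℝ) - 1 := by
  rw [coverMatrix_apply]
  simp [outDegree]

/-- Every edge lies inside `A` or joins `A` to its complement, as seen by summing the entries of the
block matrix, and a tree has one edge fewer than vertices. -/
theorem sum_outDegree_add_card_edgeFinset (hT : T.IsTree)
    (hcov : ∀ u v, T.Adj u v → u ∈ A ∨ v ∈ A) :
    ∑ a : {v // v ∈ A}, T.outDegree A a + (T.coverGraph A).edgeFinset.card + 1 =
      Fintype.card V := by
  have hsum : ∀ {W : Type _} [Fintype W] (G : SimpleGraph W) [DecidableRel G.Adj],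
      ∑ v, ∑ w, G.adjMatrix ℝ v w = 2 * (G.edgeFinset.card : ℝ) := by
    intro W _ G _
    have := G.sum_degrees_eq_twice_card_edges
    rw [show (2 : ℝ) * G.edgeFinset.card = ((2 * G.edgeFinset.card : ℕ) : ℝ) by push_cast; ring,
      ← this]
    push_cast
    refine Finset.sum_congr rfl fun v _ ↦ ?_
    simp [adjMatrix_apply, ← card_neighborFinset_eq_degree, neighborFinset_eq_filter]
  have h1 := hsum T
  have h2 := hsum (T.coverGraph A)
  have h3 : ∑ v, ∑ w, T.adjMatrix ℝ v w = ∑ x, ∑ y, Matrix.reindex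
      (Equiv.sumCompl (· ∈ A)).symm (Equiv.sumCompl (· ∈ A)).symm (T.adjMatrix ℝ) x y := by
    simp only [reindex_apply, submatrix_apply, Equiv.symm_symm]
    rw [← Equiv.sum_comp (Equiv.sumCompl (· ∈ A))]
    exact Finset.sum_congr rfl fun x _ ↦
      (Equiv.sum_comp (Equiv.sumCompl (· ∈ A)) fun w ↦ T.adjMatrix ℝ _ w).symm
  have h4 : ∀ a : {v // v ∈ A}, ∑ d, T.coverIncidence A a d = T.outDegree A a := by
    intro a
    simp [coverIncidence, outDegree]
  rw [h1, reindex_adjMatrix_eq_fromBlocks hcov, Fintype.sum_sum_type] at h3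
  simp only [Fintype.sum_sum_type, fromBlocks_apply₁₁, fromBlocks_apply₁₂, fromBlocks_apply₂₁,
    fromBlocks_apply₂₂, Finset.sum_add_distrib, transpose_apply, Matrix.zero_apply,
    Finset.sum_const_zero, add_zero, h2] at h3
  rw [Finset.sum_comm (s := (Finset.univ : Finset {v // v ∉ A}))] at h3
  simp only [h4] at h3
  rw [← hT.card_edgeFinset]
  have : ((∑ a : {v // v ∈ A}, T.outDegree A a : ℕ) : ℝ) + (T.coverGraph A).edgeFinset.card =
      T.edgeFinset.card := by
    push_cast
    linarith
  have : ∑ a : {v // v ∈ A}, T.outDegree A a + (T.coverGraph A).edgeFinset.card =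
      T.edgeFinset.card := by exact_mod_cast this
  omega

open Classical in
theorem coverMatrix_apply_of_ne (hT : T.IsTree) {a b : {v // v ∈ A}} (hab : a ≠ b) :
    T.coverMatrix A a b =
      if T.Adj a b ∨ ∃ d, d ∉ A ∧ T.Adj a d ∧ T.Adj b d then 1 else 0 := by
  rw [coverMatrix_apply, if_neg hab, sub_zero]
  by_cases hadj : T.Adj a b
  · rw [if_pos hadj, if_pos (.inl hadj), Finset.filter_eq_empty_iff.2, Finset.card_empty]
    · simp
    · exact fun d _ hd ↦ hT.common_adj_imp_not_adj hd.1 hd.2 hadj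
  rw [if_neg hadj, zero_add]
  by_cases hd : ∃ d, d ∉ A ∧ T.Adj a d ∧ T.Adj b d
  · rw [if_pos (.inr hd)]
    obtain ⟨d, hdA, h1, h2⟩ := hd
    have : (Finset.univ.filter fun d : {v // v ∉ A} ↦ T.Adj a d ∧ T.Adj b d) = {⟨d, hdA⟩} := by
      ext d'
      simp only [Finset.mem_filter, Finset.mem_univ, true_and, Finset.mem_singleton]
      refine ⟨fun h ↦ ?_, fun h ↦ by rw [h]; exact ⟨h1, h2⟩⟩
      exact Subtype.ext (hT.eq_of_two_common_adj (fun h ↦ hab (Subtype.ext h)) h.1 h.2 h1 h2)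
    rw [this]
    simp
  · rw [if_neg (not_or.2 ⟨hadj, hd⟩), Finset.filter_eq_empty_iff.2, Finset.card_empty, Nat.cast_zero]
    exact fun d _ h ↦ hd ⟨d, d.2, h⟩

theorem coverMatrix_eq_one_iff (hT : T.IsTree) {a b : {v // v ∈ A}} (hab : a ≠ b) :
    T.coverMatrix A a b = 1 ↔ T.Adj a b ∨ ∃ d, d ∉ A ∧ T.Adj a d ∧ T.Adj b d := by
  rw [coverMatrix_apply_of_ne hT hab]
  split_ifs with h <;> simp [h]

theorem coverMatrix_eq_zero_iff (hT : T.IsTree) {a b : {v // v ∈ A}} (hab : a ≠ b) :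
    T.coverMatrix A a b = 0 ↔ ¬ (T.Adj a b ∨ ∃ d, d ∉ A ∧ T.Adj a d ∧ T.Adj b d) := by
  rw [coverMatrix_apply_of_ne hT hab]
  split_ifs with h <;> simp [h]

theorem cover_connected (hT : T.IsTree) (hcov : ∀ u v, T.Adj u v → u ∈ A ∨ v ∈ A)
    (P : {v // v ∈ A} → Prop) (h0 : ∃ a, P a)
    (hP : ∀ a b, P a → T.coverMatrix A a b ≠ 0 → P b) : ∀ b, P b := by
  obtain ⟨a, ha⟩ := h0
  intro b
  have hP' : ∀ a b : {v // v ∈ A}, P a →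
      (T.Adj a b ∨ ∃ d, d ∉ A ∧ T.Adj a d ∧ T.Adj b d) → P b := by
    intro a b ha hab
    by_cases heq : a = b
    · rwa [← heq]
    · exact hP a b ha fun h ↦ (coverMatrix_eq_zero_iff hT heq).1 h hab
  -- `Q` extends `P` to all of `V`, so that it propagates along walks in the tree: an outer vertex
  -- has it when some neighbour in `A` satisfies `P`.
  let Q : V → Prop := fun v ↦ (∀ h : v ∈ A, P ⟨v, h⟩) ∧ (v ∉ A → ∃ a, P a ∧ T.Adj a v)
  have hQ : ∀ v w, Q v → T.Adj v w → Q w := by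
    intro v w hv hvw
    by_cases hvA : v ∈ A
    · exact ⟨fun hw ↦ hP' ⟨v, hvA⟩ ⟨w, hw⟩ (hv.1 hvA) (.inl hvw),
        fun _ ↦ ⟨⟨v, hvA⟩, hv.1 hvA, hvw⟩⟩
    · obtain ⟨c, hc, hcv⟩ := hv.2 hvA
      exact ⟨fun hw ↦ hP' c ⟨w, hw⟩ hc (.inr ⟨v, hvA, hcv, hvw.symm⟩),
        fun hw ↦ absurd (hcov v w hvw) (by tauto)⟩
  have hwalk : ∀ v w, T.Walk v w → Q v → Q w := by
    intro v w p
    induction p with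
    | nil => exact id
    | cons h p ih => exact fun hv ↦ ih (hQ _ _ hv h)
  obtain ⟨p⟩ := hT.1.preconnected a b
  exact (hwalk _ _ p ⟨fun _ ↦ ha, fun h ↦ absurd a.2 h⟩).1 b.2

/-- Entries 1 at both `a c` and `b c` would close the edge `ab` to a cycle of length 3, 4 or 5. Odd
lengths contradict parity of distances, and length 4 contradicts uniqueness of paths. -/
theorem cover_no_cycle (hT : T.IsTree) {a b c : {v // v ∈ A}} (hab : T.Adj a b) (hca : c ≠ a)
    (hcb : c ≠ b) (hac : T.coverMatrix A a c = 1) : T.coverMatrix A b c ≠ 1 := by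
  rw [coverMatrix_eq_one_iff hT hca.symm] at hac
  rw [ne_eq, coverMatrix_eq_one_iff hT hcb.symm]
  rintro (h2 | ⟨d', hd', hbd', hcd'⟩)
  · rcases hac with h1 | ⟨d, hd, had, hcd⟩
    · exact hT.common_adj_imp_not_adj h1 h2 hab
    · exact hca (Subtype.ext (hT.eq_of_two_common_adj (a := b) (b := d)
        (fun h ↦ hd (h ▸ b.2)) h2 hcd.symm hab.symm had.symm))
  · rcases hac with h1 | ⟨d, hd, had, hcd⟩
    · exact hcb (Subtype.ext (hT.eq_of_two_common_adj (a := a) (b := d')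
        (fun h ↦ hd' (h ▸ a.2)) h1 hcd'.symm hab hbd'.symm))
    · have e1 := hT.dist_eq_dist_add_one_of_adj (a : V) hab
      have e2 := hT.dist_eq_dist_add_one_of_adj (a : V) had
      have e3 := hT.dist_eq_dist_add_one_of_adj (a : V) hcd
      have e4 := hT.dist_eq_dist_add_one_of_adj (a : V) hbd'
      have e5 := hT.dist_eq_dist_add_one_of_adj (a : V) hcd'
      omega

theorem IsTree.exists_cover_of_isIntegralGraph (hT : T.IsTree) (hint : T.IsIntegralGraph) :
    ∃ A : Finset V, (∀ u v, T.Adj u v → u ∈ A ∨ v ∈ A) ∧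
      T.nullity + 2 * A.card = Fintype.card V ∧ (T.coverMatrix A).PosSemidef ∧
      (∀ l : ℝ, 0 < l → ∀ x : {v // v ∈ A} → ℝ, x ≠ 0 → T.coverMatrix A *ᵥ x =
        (l ^ 2 - 1) • x - (l - 1) • ((T.coverGraph A).adjMatrix ℝ *ᵥ x) → ∃ n : ℤ, l = n) := by
  obtain ⟨A, hcov, hA⟩ := hT.exists_cover
  have hK := reindex_adjMatrix_eq_fromBlocks hcov
  have hchar := charpoly_reindex (Equiv.sumCompl (· ∈ A)).symm (T.adjMatrix ℝ)
  have hrank := rank_reindex (Equiv.sumCompl (· ∈ A)).symm (Equiv.sumCompl (· ∈ A)).symm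
    (T.adjMatrix ℝ)
  rw [hK] at hchar hrank
  have hnr := nullity_add_rank T
  have hS : ((T.coverGraph A).adjMatrix ℝ).IsHermitian := by
    rw [IsHermitian, conjTranspose_eq_transpose_of_trivial, transpose_adjMatrix]
  obtain ⟨h1, h2⟩ := rank_and_posSemidef_of_blocks (B := T.coverIncidence A) hS
    (fun x hx ↦ hint x (hchar ▸ hx)) (by rw [hrank, Fintype.card_coe]; omega)
  refine ⟨A, hcov, ?_, h2, fun l hl x hx h ↦ hint l (hchar ▸ isRoot_charpoly_of_blocks hl hx h)⟩
  rw [hrank, Fintype.card_coe] at h1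
  omega

theorem exists_integralCover (hT : T.IsTree) (hint : T.IsIntegralGraph) (hnull : T.nullity = 3) :
    ∃ A : Finset V, (∀ u v, T.Adj u v → u ∈ A ∨ v ∈ A) ∧ 3 + 2 * A.card = Fintype.card V ∧
      IntegralCover (T.coverMatrix A) (T.coverGraph A) fun a ↦ T.outDegree A a - 2 := by
  obtain ⟨A, hcov, hcard, hpsd, heig⟩ := hT.exists_cover_of_isIntegralGraph hint
  rw [hnull] at hcard
  have hcount := sum_outDegree_add_card_edgeFinset hT hcov
  have hconn := cover_connected hT hcov
  -- This makes the natural subtraction in `k` exact. If it fails at `a`, the diagonal entry and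
  -- hence the whole row of `M` vanish, so `A = {a}` by connectedness; the tree then has five
  -- vertices but at most one edge.
  have hdeg : ∀ a : {v // v ∈ A}, 2 ≤ T.outDegree A a := by
    intro a
    by_contra! hlt
    have hnonneg : 0 ≤ T.coverMatrix A a a := hpsd.diag_nonneg
    have hle : T.coverMatrix A a a ≤ 0 := by
      rw [coverMatrix_apply_self]
      have : (T.outDegree A a : ℝ) ≤ 1 := by exact_mod_cast Nat.le_of_lt_succ hlt
      linarith
    have hzero : ∀ b, T.coverMatrix A b a = 0 := by
      intro b
      have := (hpsd.dotProduct_mulVec_zero_iff (Pi.single a 1)).1 (by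
        simp [le_antisymm hle hnonneg])
      simpa using congrFun this b
    have hall : ∀ b, b = a := hconn (· = a) ⟨a, rfl⟩ fun b c hb hbc ↦ by
      subst hb
      rw [← hpsd.1.apply, hzero] at hbc
      simp at hbc
    have hA : A.card = 1 := by
      rw [← Fintype.card_coe]
      exact Fintype.card_eq_one_iff.2 ⟨a, hall⟩
    have hE : (T.coverGraph A).edgeFinset.card ≤ 0 := by
      refine (T.coverGraph A).card_edgeFinset_le_card_choose_two.trans ?_
      rw [Fintype.card_coe, hA]
      rfl
    rw [Fintype.sum_eq_single a fun b hb ↦ absurd (hall b) hb] at hcount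
    omega
  refine ⟨A, hcov, hcard, hpsd, fun a ↦ ?_, fun a b hab ↦ ?_, hconn,
    fun a b c hab hca hcb hac ↦ cover_no_cycle hT hab hca hcb hac, ?_, heig⟩
  · rw [coverMatrix_apply_self, Nat.cast_sub (hdeg a)]
    push_cast
    ring
  · rw [coverMatrix_eq_one_iff hT hab, coverMatrix_eq_zero_iff hT hab]
    exact (em _).symm
  · have : ∑ a : {v // v ∈ A}, T.outDegree A a =
        ∑ a : {v // v ∈ A}, (T.outDegree A a - 2) + 2 * A.card := by
      rw [Finset.sum_congr rfl fun a _ ↦ (Nat.sub_add_cancel (hdeg a)).symm,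
        Finset.sum_add_distrib]
      simp [mul_comm]
    omega

end Cover

/-! ### Identification with the star, and the converse -/

theorem nonempty_iso_starGraph_of_isTree {V : Type*} [Fintype V] [DecidableEq V]
    {T : SimpleGraph V} [DecidableRel T.Adj] (hT : T.IsTree) (hint : T.IsIntegralGraph)
    (hnull : T.nullity = 3) : Nonempty (T ≃g starGraph (0 : Fin 5)) := by
  obtain ⟨A, hcov, hcard, hI⟩ := exists_integralCover hT hint hnull
  obtain ⟨a, -, ha⟩ := hI.exists_unique_special
  have hA : A.card = 1 := by
    rw [← Fintype.card_coe]
    exact Fintype.card_eq_one_iff.2 ⟨a, ha⟩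
  have hmem : ∀ v, v ∈ A ↔ v = a := fun v ↦
    ⟨fun hv ↦ congrArg Subtype.val (ha ⟨v, hv⟩), fun hv ↦ hv ▸ a.2⟩
  have hV : Fintype.card V = Fintype.card (Fin 5) := by rw [← hcard, hA]; rfl
  have : Nontrivial V := Fintype.one_lt_card_iff_nontrivial.1 (by rw [hV]; simp)
  have hadj : ∀ v : V, v ≠ a → T.Adj v a := by
    intro v hv
    obtain ⟨w, hw⟩ := hT.1.preconnected.exists_adj_of_nontrivial v
    rcases hcov v w hw with h | h
    · exact absurd ((hmem v).1 h) hv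
    · rwa [(hmem w).1 h] at hw
  let e := Fintype.equivOfCardEq hV
  -- The swap moves the image of the cover vertex `a` to the centre `0`.
  let e' : V ≃ Fin 5 := e.trans (Equiv.swap (e a) 0)
  have he' : ∀ v, e' v = 0 ↔ v = a := by
    intro v
    have : e' a = 0 := by simp [e']
    rw [← this, e'.apply_eq_iff_eq]
  refine ⟨⟨e', fun {v w} ↦ ?_⟩⟩
  rw [starGraph_adj, he', he', e'.injective.ne_iff]
  constructor
  · rintro ⟨hne, rfl | rfl⟩
    · exact (hadj w hne.symm).symm
    · exact hadj v hne
  · intro h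
    exact ⟨h.ne, (hcov v w h).imp (hmem v).1 (hmem w).1⟩

theorem Iso.isIntegralGraph {V W : Type*} [Fintype V] [Fintype W] [DecidableEq V] [DecidableEq W]
    {G : SimpleGraph V} {H : SimpleGraph W} [DecidableRel G.Adj] [DecidableRel H.Adj]
    (e : G ≃g H) (hH : H.IsIntegralGraph) : G.IsIntegralGraph := by
  intro x hx
  refine hH x ?_
  rwa [← e.reindex_adjMatrix ℝ, charpoly_reindex]

theorem Iso.nullity_eq {V W : Type*} [Fintype V] [Fintype W]
    {G : SimpleGraph V} {H : SimpleGraph W} [DecidableRel G.Adj] [DecidableRel H.Adj]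
    (e : G ≃g H) : G.nullity = H.nullity := by
  have h1 := nullity_add_rank G
  have h2 := nullity_add_rank H
  rw [← e.reindex_adjMatrix ℝ, rank_reindex, ← Fintype.card_congr e.toEquiv] at h2
  omega

theorem adjMatrix_starGraph_mulVec (v : Fin 5 → ℝ) :
    (starGraph (0 : Fin 5)).adjMatrix ℝ *ᵥ v =
      ![v 1 + v 2 + v 3 + v 4, v 0, v 0, v 0, v 0] := by
  ext i
  fin_cases i <;> simp [mulVec, dotProduct, Fin.sum_univ_succ, adjMatrix_apply, add_assoc]

theorem isIntegralGraph_starGraph : (starGraph (0 : Fin 5)).IsIntegralGraph := by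
  intro x hx
  rw [Polynomial.IsRoot, eval_charpoly] at hx
  obtain ⟨v, hv, hv0⟩ := exists_mulVec_eq_zero_iff.2 hx
  rw [sub_mulVec, adjMatrix_starGraph_mulVec, sub_eq_zero] at hv0
  have h : ∀ i, x * v i = ![v 1 + v 2 + v 3 + v 4, v 0, v 0, v 0, v 0] i := by
    intro i
    rw [← hv0]
    simp [Matrix.scalar_apply, mulVec_diagonal]
  have h0 := h 0
  have h1 := h 1
  have h2 := h 2
  have h3 := h 3
  have h4 := h 4
  simp at h0 h1 h2 h3 h4
  by_cases hx0 : x = 0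
  · exact ⟨0, by simp [hx0]⟩
  have hv00 : v 0 ≠ 0 := by
    intro hz
    simp only [hz, mul_eq_zero, hx0, false_or] at h1 h2 h3 h4
    apply hv
    ext i
    fin_cases i <;> assumption
  -- Multiplying the centre equation by `x` and inserting the leaf equations gives `x² * v 0 = 4 * v
  -- 0`.
  have : (x - 2) * (x + 2) = 0 := by
    apply mul_right_cancel₀ hv00
    linear_combination x * h0 + h1 + h2 + h3 + h4
  rcases mul_eq_zero.1 this with h | h
  · exact ⟨2, by push_cast; linarith⟩
  · exact ⟨-2, by push_cast; linarith⟩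

theorem nullity_starGraph : (starGraph (0 : Fin 5)).nullity = 3 := by
  have hmem : ∀ v : Fin 5 → ℝ, v ∈ LinearMap.ker ((starGraph (0 : Fin 5)).adjMatrix ℝ).mulVecLin ↔
      v 1 + v 2 + v 3 + v 4 = 0 ∧ v 0 = 0 := by
    intro v
    rw [LinearMap.mem_ker, mulVecLin_apply, adjMatrix_starGraph_mulVec]
    simp
  let f : LinearMap.ker ((starGraph (0 : Fin 5)).adjMatrix ℝ).mulVecLin →ₗ[ℝ] (Fin 3 → ℝ) :=
    LinearMap.funLeft ℝ ℝ ![1, 2, 3] ∘ₗ Submodule.subtype _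
  have hf : Function.Bijective f := by
    constructor
    · rw [← LinearMap.ker_eq_bot, LinearMap.ker_eq_bot']
      rintro ⟨v, hv⟩ h
      obtain ⟨hs, h0⟩ := (hmem v).1 hv
      have h1 : v 1 = 0 := congrFun h 0
      have h2 : v 2 = 0 := congrFun h 1
      have h3 : v 3 = 0 := congrFun h 2
      have h4 : v 4 = 0 := by linarith
      ext i
      fin_cases i <;> assumption
    · intro w
      refine ⟨⟨![0, w 0, w 1, w 2, -(w 0 + w 1 + w 2)], (hmem _).2 ?_⟩, ?_⟩
      · simp
      · ext i
        fin_cases i <;> simp [f, LinearMap.funLeft_apply]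
  rw [nullity, (LinearEquiv.ofBijective f hf).finrank_eq]
  simp

end SimpleGraph

theorem mainTheorem7 {V : Type*} [Fintype V] [DecidableEq V] (T : SimpleGraph V)
    [DecidableRel T.Adj] :
    (T.IsTree ∧ T.IsIntegralGraph ∧ T.nullity = 3) ↔
      Nonempty (T ≃g SimpleGraph.starGraph (0 : Fin 5)) := by
  refine ⟨fun ⟨hT, hint, hnull⟩ ↦ SimpleGraph.nonempty_iso_starGraph_of_isTree hT hint hnull, ?_⟩
  rintro ⟨e⟩
  exact ⟨e.isTree_iff.2 (SimpleGraph.isTree_starGraph 0),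
    e.isIntegralGraph SimpleGraph.isIntegralGraph_starGraph,
    e.nullity_eq.trans SimpleGraph.nullity_starGraph⟩
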